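/- A Peano continuum is a compact, connected, locally path connected, metrizable space; it is planar if it is homeomorphic to a subspace of the Euclidean plane $\mathbb{R}^2$. A space $X$ is semilocally simply connected at a point $x \in X$ if $x$ has a neighborhood $U$ such that every loop in $U$ based at $x$ is null-homotopic in $X$ relative to its endpoints. Let $B(X)$ denote the set of points at which $X$ is not semilocally simply connected. Let $X$ be a planar Peano continuum, and let $f : X \to X$ be a continuous map that is homotopic to the identity map of $X$. Then $f(x) = x$ for every $x \in B(X)$. -/

import Mathlib

open Topology

/-- A Peano continuum: a compact, connected (in particular nonempty), locally path connected,
metrizable topological space. -/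
structure IsPeanoContinuum (X : Type*) [TopologicalSpace X] : Prop where
  compact : CompactSpace X
  connected : ConnectedSpace X
  locallyPathConnected : LocallyPathConnectedSpace X
  metrizable : TopologicalSpace.MetrizableSpace X

/-- A planar Peano continuum: a Peano continuum that is homeomorphic to a subspace of the
Euclidean plane. -/
structure IsPlanarPeanoContinuum (X : Type*) [TopologicalSpace X] : Prop
    extends IsPeanoContinuum X where
  planar : ∃ e : X → EuclideanSpace ℝ (Fin 2), IsEmbedding e

/-- `X` is semilocally simply connected at `x`: some neighborhood `U` of `x` is such that every
loop in `U` based at `x` is null-homotopic in `X` (relative to its endpoints); in other words,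
the inclusion-induced homomorphism `π₁(U, x) → π₁(X, x)` is trivial. -/
def SemilocallySimplyConnectedAt {X : Type*} [TopologicalSpace X] (x : X) : Prop :=
  ∃ U ∈ 𝓝 x, ∀ p : Path x x, Set.range p ⊆ U → p.Homotopic (Path.refl x)

/-- The bad set `B(X)`: the points at which `X` is not semilocally simply connected. -/
def badSet (X : Type*) [TopologicalSpace X] : Set X :=
  {x | ¬ SemilocallySimplyConnectedAt x}

/-! Embed `X` in the plane by `e` and suppose `f x ≠ x`. Winding numbers show that small loops at
`x` surround no hole of `X`; planar topology then contracts them in `X`. Winding numbers appear as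
continuous logarithms: `logHull K` is `K` with its holes filled.

Take `S` so close to `x` that `e(S)` and `e(f(S))` lie in two discs far apart. A point `q` of the
hull of `e(S)` lies in the first disc, so outside the hull of `e(f(S))`, and `z - q` has a logarithm
on `e(f(S))`. If `q` were outside `e(X)`, the homotopy from `f` to the identity would avoid `q`, and
lifting it through `exp` would carry the logarithm over to `e(S)`, a contradiction. So the hull of
`e(S)` lies in `e(X)` (`exists_nhds_logHull_subset`).

It remains to contract a loop inside the hull `A` of its image. This `A` is compact, its own hull,
and uniformly locally path connected because the image of a path is. Closed lattice walks in a
filled set contract, by pushing the top left corner inwards across a square (`walkClass_eq_id`).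
Approximating paths by such walks shows that a loop in a compact set contracts in every
neighbourhood of its hull (`exists_square_filler_of_logHull_subset`). Applied on the cells of a fine
grid whose edges have been moved into `A`, this pushes a disc near `A` much closer to `A` by a small
move relative to the boundary (`exists_refinement`). Infinitely many such moves converge to a disc
in `A` (`exists_square_filler_mem`). -/

/-! ### Continuous logarithms and filled hulls of plane sets. -/

/-- `φ` has a continuous logarithm on `K`. -/
def HasLog {α : Type*} [TopologicalSpace α] (K : Set α) (φ : α → ℂ) : Prop :=
  ∃ g : α → ℂ, ContinuousOn g K ∧ ∀ z ∈ K, Complex.exp (g z) = φ z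

/-- The points `q` around which `z - q` has no continuous logarithm on `K`. For compact `K` this is
`K` together with the bounded components of its complement. -/
def logHull (K : Set ℂ) : Set ℂ := {q | ¬ HasLog K (fun z => z - q)}

theorem HasLog.mono {α : Type*} [TopologicalSpace α] {K L : Set α} {φ : α → ℂ}
    (h : HasLog L φ) (hKL : K ⊆ L) : HasLog K φ := by
  obtain ⟨g, hg, he⟩ := h
  exact ⟨g, hg.mono hKL, fun z hz => he z (hKL hz)⟩

theorem HasLog.congr {α : Type*} [TopologicalSpace α] {K : Set α} {φ ψ : α → ℂ}
    (h : HasLog K φ) (hφ : ∀ z ∈ K, φ z = ψ z) : HasLog K ψ := by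
  obtain ⟨g, hg, he⟩ := h
  exact ⟨g, hg, fun z hz => (he z hz).trans (hφ z hz)⟩

theorem HasLog.mul {α : Type*} [TopologicalSpace α] {K : Set α} {φ ψ : α → ℂ}
    (h : HasLog K φ) (h' : HasLog K ψ) : HasLog K (fun z => φ z * ψ z) := by
  obtain ⟨g, hg, he⟩ := h
  obtain ⟨g', hg', he'⟩ := h'
  exact ⟨fun z => g z + g' z, hg.add hg', fun z hz => by rw [Complex.exp_add, he z hz, he' z hz]⟩

theorem hasLog_of_mem_slitPlane {α : Type*} [TopologicalSpace α] {K : Set α} {φ : α → ℂ}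
    (hφ : ContinuousOn φ K) (h : ∀ z ∈ K, φ z ∈ Complex.slitPlane) : HasLog K φ :=
  ⟨fun z => Complex.log (φ z), hφ.clog h,
    fun z hz => Complex.exp_log (Complex.slitPlane_ne_zero (h z hz))⟩

theorem hasLog_of_norm_sub_one_lt {α : Type*} [TopologicalSpace α] {K : Set α} {φ : α → ℂ}
    (hφ : ContinuousOn φ K) (h : ∀ z ∈ K, ‖φ z - 1‖ < 1) : HasLog K φ := by
  refine hasLog_of_mem_slitPlane hφ fun z hz => ?_
  have := Complex.mem_slitPlane_of_norm_lt_one (h z hz)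
  simpa using this

theorem hasLog_const {α : Type*} [TopologicalSpace α] (K : Set α) {c : ℂ} (hc : c ≠ 0) :
    HasLog K (fun _ => c) :=
  ⟨fun _ => Complex.log c, continuousOn_const, fun _ _ => Complex.exp_log hc⟩

/-- The quotient `(z - q) / (z - q')` stays within distance less than `1` of `1`, so it has a
principal logarithm: moving `q` without coming near `K` changes no winding number. -/
theorem hasLog_sub_of_dist_lt {K : Set ℂ} {q q' : ℂ} (h : ∀ z ∈ K, dist q q' < dist z q')
    (hq : HasLog K (fun z => z - q')) : HasLog K (fun z => z - q) := by
  have hne : ∀ z ∈ K, z - q' ≠ 0 := fun z hz => by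
    have := (dist_nonneg.trans_lt (h z hz))
    exact sub_ne_zero.2 (dist_pos.1 this)
  have h2 : HasLog K (fun z => (z - q) / (z - q')) := by
    refine hasLog_of_norm_sub_one_lt (ContinuousOn.div (by fun_prop) (by fun_prop) hne) ?_
    intro z hz
    have e : (z - q) / (z - q') - 1 = (q' - q) / (z - q') := by
      field_simp [hne z hz]; ring
    rw [e, norm_div, div_lt_one (norm_pos_iff.2 (hne z hz))]
    have := h z hz
    rwa [dist_comm, dist_eq_norm, dist_eq_norm] at this
  exact (hq.mul h2).congr fun z hz => by field_simp [hne z hz]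

theorem subset_logHull (K : Set ℂ) : K ⊆ logHull K := by
  rintro q hq ⟨g, -, he⟩
  exact Complex.exp_ne_zero _ ((he q hq).trans (sub_self q))

theorem logHull_mono {K L : Set ℂ} (h : K ⊆ L) : logHull K ⊆ logHull L :=
  fun _ hq hl => hq (hl.mono h)

/-- Seen from `q` outside the ball, `(z - q) / (c - q)` is closer to `1` than `1`, so the principal
branch serves. -/
theorem logHull_subset_closedBall {K : Set ℂ} {c : ℂ} {r : ℝ} (h : K ⊆ Metric.closedBall c r) :
    logHull K ⊆ Metric.closedBall c r := by
  intro q hq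
  by_contra hqr
  rw [Metric.mem_closedBall, not_le] at hqr
  refine hq ?_
  have hc : c - q ≠ 0 := by
    rcases K.eq_empty_or_nonempty with rfl | ⟨z, hz⟩
    · exact absurd ⟨fun _ => 0, continuousOn_empty _, by simp⟩ hq
    · have h1 : 0 ≤ r := dist_nonneg.trans (h hz)
      exact sub_ne_zero.2 (dist_pos.1 (by rw [dist_comm]; linarith))
  have h2 : HasLog K (fun z => (z - q) / (c - q)) := by
    refine hasLog_of_norm_sub_one_lt (by fun_prop) ?_
    intro z hz
    have e : (z - q) / (c - q) - 1 = (z - c) / (c - q) := by field_simp; ring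
    rw [e, norm_div, div_lt_one (norm_pos_iff.2 hc)]
    have := h hz
    rw [Metric.mem_closedBall, dist_eq_norm] at this
    rw [dist_comm, dist_eq_norm] at hqr
    linarith
  exact ((hasLog_const K hc).mul h2).congr fun z hz => by field_simp

/-- Logarithms extend along homotopies of nonvanishing functions. -/
theorem exists_log_of_homotopy {α : Type*} [TopologicalSpace α] (H : C(unitInterval × α, ℂ))
    (hH : ∀ p, H p ≠ 0) (g : C(α, ℂ)) (hg : ∀ a, Complex.exp (g a) = H (0, a)) :
    ∃ g' : C(α, ℂ), ∀ a, Complex.exp (g' a) = H (1, a) := by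
  let H' : C(unitInterval × α, {z : ℂ // z ≠ 0}) := ⟨fun p => ⟨H p, hH p⟩, by fun_prop⟩
  have h0 : ∀ a, H' (0, a) = (fun z : ℂ ↦ (⟨_, z.exp_ne_zero⟩ : {z : ℂ // z ≠ 0})) (g a) :=
    fun a => Subtype.ext (hg a).symm
  let L := Complex.isCoveringMap_exp.liftHomotopy H' g h0
  refine ⟨⟨fun a => L (1, a), by fun_prop⟩, fun a => ?_⟩
  have := congrFun (Complex.isCoveringMap_exp.liftHomotopy_lifts H' g h0) (1, a)
  exact congrArg Subtype.val this

theorem exists_log_of_ne_zero (φ : C(ℂ, ℂ)) (hφ : ∀ z, φ z ≠ 0) :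
    ∃ L : C(ℂ, ℂ), ∀ z, Complex.exp (L z) = φ z := by
  obtain ⟨L, ⟨-, hL⟩, -⟩ := Complex.isCoveringMapOn_exp.existsUnique_continuousMap_lifts φ
    (a₀ := 0) (e₀ := Complex.log (φ 0)) (Complex.exp_log (hφ 0)) hφ
  exact ⟨L, fun z => congrFun hL z⟩

theorem HasLog.exists_continuousMap {K : Set ℂ} (hK : IsClosed K) {φ : ℂ → ℂ} (h : HasLog K φ) :
    ∃ G : C(ℂ, ℂ), ∀ z ∈ K, Complex.exp (G z) = φ z := by
  obtain ⟨g, hg, he⟩ := h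
  obtain ⟨G, hG⟩ := ContinuousMap.exists_restrict_eq hK
    (⟨K.domRestrict g, continuousOn_iff_continuous_domRestrict.mp hg⟩ : C(K, ℂ))
  refine ⟨G, fun z hz => ?_⟩
  rw [← he z hz]
  exact congrArg _ (DFunLike.congr_fun hG ⟨z, hz⟩)

/-- A logarithm on the frontier of `B` of a function that is nonvanishing on `B` yields one
on `B`. -/
theorem HasLog.of_frontier {K B : Set ℂ} (hK : IsClosed K) (hB : IsClosed B)
    (hBK : frontier B ⊆ K) {φ : ℂ → ℂ} (hφ : ContinuousOn φ B) (hne : ∀ z ∈ B, φ z ≠ 0)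
    (h : HasLog K φ) : HasLog B φ := by
  classical
  obtain ⟨G, hG⟩ := h.exists_continuousMap hK
  -- On the frontier `φ * exp (-G)` equals `1`, so continuing it by `1` outside `B` gives a nowhere
  -- zero map on the whole plane, which has a logarithm.
  have hc : Continuous (B.piecewise (fun z => φ z * Complex.exp (-G z)) (fun _ => 1)) := by
    refine continuous_piecewise ?_ ?_ continuousOn_const
    · intro z hz
      rw [← hG z (hBK hz), ← Complex.exp_add]; simp
    · rw [hB.closure_eq]
      exact hφ.mul (by fun_prop)
  obtain ⟨L, hL⟩ := exists_log_of_ne_zero ⟨_, hc⟩ (fun z => by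
    by_cases hz : z ∈ B
    · simpa [hz] using hne z hz
    · simp [hz])
  refine ⟨fun z => L z + G z, by fun_prop, fun z hz => ?_⟩
  rw [Complex.exp_add, hL z]
  simp [hz, mul_assoc, ← Complex.exp_add]

/-- Having a logarithm is stable under moving `q` and enlarging `K`: with `G` a logarithm extended
to the plane, `(z - q') * exp (-G z)` is `1` on `{q} × K`, hence near `1` on a tube around it. -/
theorem HasLog.exists_cthickening {K : Set ℂ} (hK : IsCompact K) {q : ℂ}
    (h : HasLog K (fun z => z - q)) :
    ∃ δ > 0, ∀ q' ∈ Metric.ball q δ, HasLog (Metric.cthickening δ K) (fun z => z - q') := by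
  obtain ⟨G, hG⟩ := h.exists_continuousMap hK.isClosed
  let ψ : ℂ × ℂ → ℂ := fun p => (p.2 - p.1) * Complex.exp (-G p.2)
  have hψ : Continuous ψ := by fun_prop
  have hO : IsOpen {p | ‖ψ p - 1‖ < 1} := isOpen_lt (by fun_prop) continuous_const
  obtain ⟨u, v, hu, hv, hqu, hKv, huv⟩ := generalized_tube_lemma (isCompact_singleton (x := q)) hK
    hO (by
      rintro ⟨a, b⟩ ⟨ha, hb⟩
      rw [Set.mem_singleton_iff] at ha
      subst ha
      have : ψ (a, b) = 1 := by
        simp only [ψ]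
        rw [← hG b hb, ← Complex.exp_add]; simp
      simp [this])
  obtain ⟨δ₁, hδ₁, h1⟩ := Metric.isOpen_iff.1 hu q (hqu rfl)
  obtain ⟨δ₂, hδ₂, h2⟩ := hK.exists_cthickening_subset_open hv hKv
  refine ⟨min δ₁ δ₂, lt_min hδ₁ hδ₂, fun q' hq' => ?_⟩
  have hq'' : q' ∈ u := h1 (Metric.ball_subset_ball (min_le_left _ _) hq')
  have h3 : HasLog (Metric.cthickening (min δ₁ δ₂) K) (fun z => ψ (q', z)) := by
    refine hasLog_of_norm_sub_one_lt (by fun_prop) fun z hz => ?_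
    exact huv (Set.mk_mem_prod hq'' (h2 (Metric.cthickening_mono (min_le_right _ _) _ hz)))
  refine (h3.mul ⟨G, by fun_prop, fun _ _ => rfl⟩).congr fun z hz => ?_
  simp [ψ, mul_assoc, ← Complex.exp_add]

theorem isClosed_logHull {K : Set ℂ} (hK : IsCompact K) : IsClosed (logHull K) := by
  rw [← isOpen_compl_iff, Metric.isOpen_iff]
  intro q hq
  obtain ⟨δ, hδ, h⟩ := HasLog.exists_cthickening hK (not_not.1 hq)
  exact ⟨δ, hδ, fun q' hq' => not_not.2 ((h q' hq').mono (Metric.self_subset_cthickening K))⟩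

theorem isCompact_logHull {K : Set ℂ} (hK : IsCompact K) : IsCompact (logHull K) := by
  obtain ⟨r, hr⟩ := hK.isBounded.subset_closedBall 0
  exact (isCompact_closedBall 0 r).of_isClosed_subset (isClosed_logHull hK)
    (logHull_subset_closedBall hr)

theorem isOpen_logHull_diff {K : Set ℂ} (hK : IsCompact K) : IsOpen (logHull K \ K) := by
  rw [Metric.isOpen_iff]
  rintro q ⟨hq, hqK⟩
  obtain ⟨δ, hδ, h⟩ := Metric.isOpen_iff.1 hK.isClosed.isOpen_compl q hqK
  refine ⟨δ / 2, by positivity, fun q' hq' => ⟨fun hl => hq ?_, ?_⟩⟩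
  · refine hasLog_sub_of_dist_lt (fun z hz => ?_) hl
    have h1 : δ ≤ dist z q := by
      by_contra hc
      exact h (Metric.mem_ball.2 (not_le.1 hc)) hz
    rw [Metric.mem_ball] at hq'
    have := dist_triangle z q' q
    rw [dist_comm q q']
    linarith
  · exact h (Metric.ball_subset_ball (by linarith) hq')

theorem frontier_logHull_subset {K : Set ℂ} (hK : IsCompact K) : frontier (logHull K) ⊆ K := by
  intro z hz
  by_contra hzK
  rw [(isClosed_logHull hK).frontier_eq] at hz
  exact hz.2 (interior_maximal Set.sdiff_subset (isOpen_logHull_diff hK) ⟨hz.1, hzK⟩)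

/-- Off `K` the hull is both open and closed, so a connected set that misses `K` cannot leave it. -/
theorem IsPreconnected.subset_logHull {K Z : Set ℂ} (hK : IsCompact K) (hZ : IsPreconnected Z)
    (hd : Disjoint Z K) {a : ℂ} (ha : a ∈ Z) (haK : a ∈ logHull K) : Z ⊆ logHull K := by
  refine (hZ.subset_left_of_subset_union (isOpen_logHull_diff hK)
    (isClosed_logHull hK).isOpen_compl ?_ ?_ ⟨a, ha, haK, hd.notMem_of_mem_left ha⟩).trans
    Set.sdiff_subset
  · exact Set.disjoint_left.2 fun z hz hz' => hz' hz.1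
  · intro z hz
    by_cases h : z ∈ logHull K
    · exact Or.inl ⟨h, hd.notMem_of_mem_left hz⟩
    · exact Or.inr h

theorem logHull_logHull {K : Set ℂ} (hK : IsCompact K) : logHull (logHull K) = logHull K := by
  refine Set.Subset.antisymm (fun q hq => ?_) (subset_logHull _)
  by_contra h
  refine hq (HasLog.of_frontier hK.isClosed (isClosed_logHull hK) (frontier_logHull_subset hK)
    (by fun_prop) (fun z hz hzq => ?_) (not_not.1 h))
  rw [sub_eq_zero] at hzq
  exact h (hzq ▸ hz)

/-- `k / (2πi)` is continuous and integer valued. -/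
theorem exists_const_of_exp_eq_one {α : Type*} [TopologicalSpace α] {S : Set α}
    (hS : IsPreconnected S) {k : α → ℂ} (hk : ContinuousOn k S)
    (he : ∀ z ∈ S, Complex.exp (k z) = 1) : ∃ c, Complex.exp c = 1 ∧ ∀ z ∈ S, k z = c := by
  have := isPreconnected_iff_preconnectedSpace.1 hS
  have hp : (2 * Real.pi * Complex.I : ℂ) ≠ 0 := Complex.two_pi_I_ne_zero
  choose n hn using fun z : S => Complex.exp_eq_one_iff.1 (he z z.2)
  have hnc : Continuous n := by
    have h1 : Continuous (fun z : S => k z / (2 * Real.pi * Complex.I)) :=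
      (continuousOn_iff_continuous_domRestrict.mp hk).div_const _
    have h2 : Continuous (fun z => ((n z : ℤ) : ℝ)) := by
      refine (Complex.continuous_re.comp h1).congr fun z => ?_
      simp only [Function.comp_apply]
      rw [hn z, mul_div_cancel_right₀ _ hp]
      simp
    exact Int.isClosedEmbedding_coe_real.isInducing.continuous_iff.2 h2
  rcases S.eq_empty_or_nonempty with rfl | ⟨z₀, hz₀⟩
  · exact ⟨0, by simp, by simp⟩
  · refine ⟨k z₀, he _ hz₀, fun z hz => ?_⟩
    rw [hn ⟨z, hz⟩, hn ⟨z₀, hz₀⟩, PreconnectedSpace.constant ‹_› hnc (x := ⟨z, hz⟩) (y := ⟨z₀, hz₀⟩)]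

/-- Logarithms on two closed sets with connected intersection yield one on the union. -/
theorem HasLog.union {α : Type*} [TopologicalSpace α] {A B : Set α} (hA : IsClosed A)
    (hB : IsClosed B) (hAB : IsPreconnected (A ∩ B)) {φ : α → ℂ} (h : HasLog A φ)
    (h' : HasLog B φ) : HasLog (A ∪ B) φ := by
  classical
  obtain ⟨g, hg, he⟩ := h
  obtain ⟨g', hg', he'⟩ := h'
  obtain ⟨c, hc, hk⟩ := exists_const_of_exp_eq_one hAB (k := fun z => g z - g' z)
    ((hg.mono Set.inter_subset_left).sub (hg'.mono Set.inter_subset_right))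
    (fun z hz => by
      rw [Complex.exp_sub, he z hz.1, he' z hz.2, div_self]
      rw [← he z hz.1]; exact Complex.exp_ne_zero _)
  refine ⟨A.piecewise g (fun z => g' z + c), ?_, ?_⟩
  · refine ContinuousOn.union_of_isClosed (hg.congr fun z hz => by simp [hz])
      ((hg'.add (continuousOn_const (c := c))).congr fun z hz => ?_) hA hB
    show _ = g' z + c
    by_cases hzA : z ∈ A
    · rw [Set.piecewise_eq_of_mem _ _ _ hzA, ← hk z ⟨hzA, hz⟩]; simp
    · simp [hzA]
  · rintro z hz
    by_cases hzA : z ∈ A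
    · rw [Set.piecewise_eq_of_mem _ _ _ hzA, he z hzA]
    · rw [Set.piecewise_eq_of_notMem _ _ _ hzA, Complex.exp_add, hc, mul_one,
        he' z (hz.resolve_left hzA)]

/-- Along `q + R * exp (it)` a logarithm differs from `it + log R` by a constant, so it gains `2πi`
in one turn and cannot close up. -/
theorem not_hasLog_sphere (q : ℂ) {R : ℝ} (hR : 0 < R) :
    ¬ HasLog (Metric.sphere q R) (fun z => z - q) := by
  rintro ⟨g, hg, he⟩
  let c : ℝ → ℂ := fun t => q + R * Complex.exp (t * Complex.I)
  have hc : ∀ t, c t ∈ Metric.sphere q R := fun t => by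
    simp [c, Complex.norm_exp_ofReal_mul_I, abs_of_pos hR]
  have hcc : Continuous c := by fun_prop
  have hgc : Continuous (fun t => g (c t)) := hg.comp_continuous hcc hc
  obtain ⟨w, -, hw⟩ := exists_const_of_exp_eq_one isPreconnected_univ
    (k := fun t : ℝ => g (c t) - t * Complex.I - Complex.log R)
    ((hgc.sub (by fun_prop)).sub continuous_const).continuousOn (fun t _ => by
      rw [Complex.exp_sub, Complex.exp_sub, he _ (hc t), Complex.exp_log (by exact_mod_cast hR.ne')]
      have := Complex.exp_ne_zero (t * Complex.I)
      have h2 : (R : ℂ) ≠ 0 := by exact_mod_cast hR.ne'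
      simp only [c]; field_simp; ring)
  have h1 := (hw (2 * Real.pi) trivial).trans (hw 0 trivial).symm
  have hcp : c (2 * Real.pi) = c 0 := by simp [c]
  rw [hcp] at h1
  refine Complex.two_pi_I_ne_zero ?_
  push_cast at h1
  linear_combination -h1

/-- A logarithm on the frontier would extend over the complement of `U`, which contains a large
circle around `q`. -/
theorem subset_logHull_frontier {U : Set ℂ} (hU : IsOpen U) (hb : Bornology.IsBounded U) :
    U ⊆ logHull (frontier U) := by
  intro q hq hl
  obtain ⟨R, hR, h⟩ := hb.subset_ball_lt 0 q
  have hl' : HasLog Uᶜ (fun z => z - q) :=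
    HasLog.of_frontier isClosed_frontier hU.isClosed_compl (by rw [frontier_compl])
      (by fun_prop) (fun z hz hzq => hz (sub_eq_zero.1 hzq ▸ hq)) hl
  refine not_hasLog_sphere q hR (hl'.mono fun z hz hzU => ?_)
  have h1 := Metric.mem_ball.1 (h hzU)
  rw [Metric.mem_sphere] at hz
  linarith

/-- All hulls in question lie in one closed ball. The part of it outside `N` is compact, and each of
its points is, locally uniformly, outside the hull of some thickening. -/
theorem exists_logHull_cthickening_subset {K N : Set ℂ} (hK : IsCompact K) (hN : IsOpen N)
    (h : logHull K ⊆ N) : ∃ δ > 0, logHull (Metric.cthickening δ K) ⊆ N := by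
  obtain ⟨r, hr⟩ := (hK.cthickening (r := 1)).isBounded.subset_closedBall (0 : ℂ)
  have hC : IsCompact (Metric.closedBall (0 : ℂ) r \ N) := (isCompact_closedBall 0 r).diff hN
  have key : ∃ δ > 0, ∀ q ∈ Metric.closedBall (0 : ℂ) r \ N,
      HasLog (Metric.cthickening δ K) (fun z => z - q) := by
    refine hC.induction_on (p := fun C => ∃ δ > 0, ∀ q ∈ C,
      HasLog (Metric.cthickening δ K) (fun z => z - q)) ⟨1, one_pos, by simp⟩ ?_ ?_ ?_
    · rintro s t hst ⟨δ, hδ, h⟩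
      exact ⟨δ, hδ, fun q hq => h q (hst hq)⟩
    · rintro s t ⟨δ, hδ, h⟩ ⟨δ', hδ', h'⟩
      refine ⟨min δ δ', lt_min hδ hδ', ?_⟩
      rintro q (hq | hq)
      · exact (h q hq).mono (Metric.cthickening_mono (min_le_left _ _) _)
      · exact (h' q hq).mono (Metric.cthickening_mono (min_le_right _ _) _)
    · intro q hq
      obtain ⟨δ, hδ, hl⟩ := HasLog.exists_cthickening hK (not_not.1 fun hh => hq.2 (h hh))
      exact ⟨_, mem_nhdsWithin_of_mem_nhds (Metric.ball_mem_nhds q hδ), δ, hδ, hl⟩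
  obtain ⟨δ, hδ, hl⟩ := key
  refine ⟨min δ 1, lt_min hδ one_pos, fun q hq => ?_⟩
  by_contra hqN
  have h1 : q ∈ Metric.closedBall (0 : ℂ) r := logHull_subset_closedBall
    ((Metric.cthickening_mono (min_le_right _ _) _).trans hr) hq
  exact hq ((hl q ⟨h1, hqN⟩).mono (Metric.cthickening_mono (min_le_left _ _) _))

/-! ### Turning path homotopies into filled squares. -/

/-- The path `(0,0) → (1,0) → (1,1)` minus its mirror image interpolate to a parametrization of the
square. -/
noncomputable def squareSweep (p : unitInterval × unitInterval) : unitInterval × unitInterval :=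
  (⟨(1 - (p.1 : ℝ)) * min (2 * (p.2 : ℝ)) 1 + (p.1 : ℝ) * max (2 * (p.2 : ℝ) - 1) 0, by
      have h1 := p.1.2.1; have h2 := p.1.2.2; have h3 := p.2.2.1; have h4 := p.2.2.2
      have h5 : (0 : ℝ) ≤ min (2 * (p.2 : ℝ)) 1 := le_min (by linarith) zero_le_one
      have h6 : (min (2 * (p.2 : ℝ)) 1 : ℝ) ≤ 1 := min_le_right _ _
      have h7 : (0 : ℝ) ≤ max (2 * (p.2 : ℝ) - 1) 0 := le_max_right _ _
      have h8 : (max (2 * (p.2 : ℝ) - 1) 0 : ℝ) ≤ 1 := max_le (by linarith) zero_le_one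
      constructor <;> nlinarith⟩,
   ⟨(1 - (p.1 : ℝ)) * max (2 * (p.2 : ℝ) - 1) 0 + (p.1 : ℝ) * min (2 * (p.2 : ℝ)) 1, by
      have h1 := p.1.2.1; have h2 := p.1.2.2; have h3 := p.2.2.1; have h4 := p.2.2.2
      have h5 : (0 : ℝ) ≤ min (2 * (p.2 : ℝ)) 1 := le_min (by linarith) zero_le_one
      have h6 : (min (2 * (p.2 : ℝ)) 1 : ℝ) ≤ 1 := min_le_right _ _
      have h7 : (0 : ℝ) ≤ max (2 * (p.2 : ℝ) - 1) 0 := le_max_right _ _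
      have h8 : (max (2 * (p.2 : ℝ) - 1) 0 : ℝ) ≤ 1 := max_le (by linarith) zero_le_one
      constructor <;> nlinarith⟩)

theorem continuous_squareSweep : Continuous squareSweep := by
  unfold squareSweep
  fun_prop

theorem squareSweep_surjective : Function.Surjective squareSweep := by
  rintro ⟨⟨x, hx0, hx1⟩, ⟨y, hy0, hy1⟩⟩
  rcases le_total (x + y) 1 with h | h
  · by_cases h0 : x + y = 0
    · refine ⟨(0, 0), ?_⟩
      ext <;> simp [squareSweep] <;> linarith
    · have hp : 0 < x + y := lt_of_le_of_ne (by linarith) (Ne.symm h0)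
      refine ⟨(⟨y / (x + y), by positivity, by rw [div_le_one hp]; linarith⟩,
        ⟨(x + y) / 2, by positivity, by linarith⟩), ?_⟩
      have e1 : min (2 * ((x + y) / 2)) 1 = x + y := by rw [min_eq_left] <;> linarith
      have e2 : max (2 * ((x + y) / 2) - 1) 0 = 0 := by rw [max_eq_right]; linarith
      ext <;> simp only [squareSweep, e1, e2] <;> field_simp <;> ring
  · by_cases h0 : x + y = 2
    · refine ⟨(0, 1), ?_⟩
      ext <;> simp [squareSweep] <;> norm_num <;> linarith
    · have hp : 0 < 2 - (x + y) := lt_of_le_of_ne (by linarith) (fun hh => h0 (by linarith))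
      refine ⟨(⟨(1 - x) / (2 - (x + y)), div_nonneg (by linarith) hp.le,
        by rw [div_le_one hp]; linarith⟩,
        ⟨(x + y) / 2, by positivity, by linarith⟩), ?_⟩
      have e1 : min (2 * ((x + y) / 2)) 1 = 1 := by rw [min_eq_right]; linarith
      have e2 : max (2 * ((x + y) / 2) - 1) 0 = x + y - 1 := by rw [max_eq_left] <;> linarith
      ext <;> simp only [squareSweep, e1, e2] <;> field_simp <;> ring

/-- The coordinates of the image sum to `2s`, which recovers `s`; on that antidiagonal the map is
affine in `τ`, with nonzero slope unless `s` is `0` or `1`. -/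
theorem squareSweep_eq {p q : unitInterval × unitInterval} (h : squareSweep p = squareSweep q) :
    p = q ∨ (p.2 = 0 ∧ q.2 = 0) ∨ (p.2 = 1 ∧ q.2 = 1) := by
  obtain ⟨⟨τ, _, _⟩, ⟨s, hs0, hs1⟩⟩ := p
  obtain ⟨⟨τ', _, _⟩, ⟨s', hs0', hs1'⟩⟩ := q
  have ha : ∀ u : ℝ, min (2 * u) 1 + max (2 * u - 1) 0 = 2 * u := fun u => by
    rcases le_total (2 * u) 1 with h | h
    · rw [min_eq_left h, max_eq_right (by linarith)]; ring
    · rw [min_eq_right h, max_eq_left (by linarith)]; ring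
  have e1 := congrArg (fun z => (z.1 : ℝ)) h
  have e2 := congrArg (fun z => (z.2 : ℝ)) h
  simp only [squareSweep] at e1 e2
  have es : s = s' := by linarith [ha s, ha s']
  subst es
  by_cases h0 : s = 0
  · right; left; constructor <;> ext <;> simp [h0]
  by_cases h1 : s = 1
  · right; right; constructor <;> ext <;> simp [h1]
  left
  have hd : 0 < min (2 * s) 1 - max (2 * s - 1) 0 := by
    have : 0 < s := lt_of_le_of_ne hs0 (Ne.symm h0)
    have : s < 1 := lt_of_le_of_ne hs1 h1
    rw [sub_pos, max_lt_iff, lt_min_iff, lt_min_iff]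
    refine ⟨⟨?_, ?_⟩, ?_, ?_⟩ <;> linarith
  have : (τ - τ') * (min (2 * s) 1 - max (2 * s - 1) 0) = 0 := by linarith
  have hτ : τ = τ' := by
    rcases mul_eq_zero.1 this with h | h <;> linarith
  subst hτ; rfl

/-- A homotopy between the two ways around a square fills the square. -/
theorem exists_square_filler {Y : Type*} [TopologicalSpace Y] {x₀₀ x₁₀ x₀₁ x₁₁ : Y}
    (b : Path x₀₀ x₁₀) (r : Path x₁₀ x₁₁) (l : Path x₀₀ x₀₁) (t : Path x₀₁ x₁₁)
    (h : (b.trans r).Homotopic (l.trans t)) :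
    ∃ F : C(unitInterval × unitInterval, Y), (∀ x, F (x, 0) = b x) ∧ (∀ x, F (x, 1) = t x) ∧
      (∀ y, F (0, y) = l y) ∧ (∀ y, F (1, y) = r y) := by
  obtain ⟨G⟩ := h
  -- The sweep collapses only the two sides on which `G`, having fixed endpoints, is constant, so
  -- `G` descends to the square.
  have hq : IsQuotientMap (⟨squareSweep, continuous_squareSweep⟩ :
      C(unitInterval × unitInterval, unitInterval × unitInterval)) :=
    continuous_squareSweep.isClosedMap.isQuotientMap continuous_squareSweep squareSweep_surjective
  have hcompat : ∀ p q, squareSweep p = squareSweep q → G p = G q := by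
    rintro ⟨τ, s⟩ ⟨τ', s'⟩ h
    rcases squareSweep_eq h with h | ⟨h1, h2⟩ | ⟨h1, h2⟩
    · rw [h]
    · simp only at h1 h2; subst h1 h2; simp
    · simp only at h1 h2; subst h1 h2; simp
  let F : C(unitInterval × unitInterval, Y) := hq.lift G.toContinuousMap hcompat
  have hF : ∀ p, F (squareSweep p) = G p := fun p =>
    DFunLike.congr_fun (hq.lift_comp G.toContinuousMap hcompat) p
  have half : ∀ x : unitInterval, (x : ℝ) / 2 ∈ unitInterval := fun x =>
    ⟨by have := x.2.1; linarith, by have := x.2.2; linarith⟩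
  have half' : ∀ x : unitInterval, ((x : ℝ) + 1) / 2 ∈ unitInterval := fun x =>
    ⟨by have := x.2.1; linarith, by have := x.2.2; linarith⟩
  have hx1 : ∀ x : unitInterval, min (2 * ((x : ℝ) / 2)) 1 = x := fun x => by
    rw [min_eq_left] <;> have := x.2.2 <;> linarith
  have hx2 : ∀ x : unitInterval, max (2 * ((x : ℝ) / 2) - 1) 0 = 0 := fun x => by
    rw [max_eq_right]; have := x.2.2; linarith
  have hx3 : ∀ x : unitInterval, min (2 * (((x : ℝ) + 1) / 2)) 1 = 1 := fun x => by
    rw [min_eq_right]; have := x.2.1; linarith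
  have hx4 : ∀ x : unitInterval, max (2 * (((x : ℝ) + 1) / 2) - 1) 0 = x := fun x => by
    rw [max_eq_left] <;> have := x.2.1 <;> linarith
  have tr1 : ∀ {a b c : Y} (p : Path a b) (q : Path b c) (x : unitInterval),
      (p.trans q) ⟨x / 2, half x⟩ = p x := fun p q x => by
    rw [Path.trans_apply, dif_pos (show (x : ℝ) / 2 ≤ 1 / 2 by have := x.2.2; linarith)]
    congr 1; ext; simp only; ring
  have tr2 : ∀ {a b c : Y} (p : Path a b) (q : Path b c) (x : unitInterval),
      (p.trans q) ⟨(x + 1) / 2, half' x⟩ = q x := fun p q x => by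
    rw [Path.trans_apply]
    split_ifs with hx
    · have : x = 0 := by ext; have h0 := x.2.1; simp only at hx; exact le_antisymm (by simp; linarith) h0
      subst this
      rw [Path.source]
      convert p.target using 2; ext; simp
    · congr 1; ext; simp only; ring
  refine ⟨F, fun x => ?_, fun x => ?_, fun y => ?_, fun y => ?_⟩
  · refine Eq.trans ?_ ((hF (0, ⟨x / 2, half x⟩)).trans ((G.apply_zero _).trans (tr1 b r x)))
    congr 1; ext <;> simp [squareSweep, hx1, hx2]
  · refine Eq.trans ?_ ((hF (1, ⟨(x + 1) / 2, half' x⟩)).trans ((G.apply_one _).trans (tr2 l t x)))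
    congr 1; ext <;> simp only [squareSweep, hx3, hx4] <;> simp
  · refine Eq.trans ?_ ((hF (1, ⟨y / 2, half y⟩)).trans ((G.apply_one _).trans (tr1 l t y)))
    congr 1; ext <;> simp [squareSweep, hx1, hx2]
  · refine Eq.trans ?_ ((hF (0, ⟨(y + 1) / 2, half' y⟩)).trans ((G.apply_zero _).trans (tr2 b r y)))
    congr 1; ext <;> simp only [squareSweep, hx3, hx4] <;> simp

/-! ### Convex homotopies and squares in filled sets. -/

/-- Two paths with the same endpoints inside a convex subset `C` of `N` are homotopic in `N`. -/
theorem Path.homotopic_of_convex {N : Set ℂ} {a b : N} (p q : Path a b) {C : Set ℂ}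
    (hC : Convex ℝ C) (hCN : C ⊆ N) (hp : ∀ s, (p s : ℂ) ∈ C) (hq : ∀ s, (q s : ℂ) ∈ C) :
    p.Homotopic q := by
  have hmem : ∀ x : unitInterval × unitInterval,
      (1 - (x.1 : ℝ)) • (p x.2 : ℂ) + (x.1 : ℝ) • (q x.2 : ℂ) ∈ C := fun x =>
    hC (hp _) (hq _) (by have := x.1.2.2; linarith) x.1.2.1 (by ring)
  refine ⟨⟨⟨⟨fun x => ⟨_, hCN (hmem x)⟩, by fun_prop⟩, ?_, ?_⟩, ?_⟩⟩
  · intro s; ext; simp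
  · intro s; ext; simp
  · rintro τ s (rfl | rfl)
    · ext
      simp; ring
    · ext
      simp; ring

/-- The straight path in `N`. -/
noncomputable def segmentPath {N : Set ℂ} (a b : N) (h : segment ℝ (a : ℂ) b ⊆ N) : Path a b where
  toFun s := ⟨Path.segment (a : ℂ) b s, h (by rw [← Path.range_segment]; exact ⟨s, rfl⟩)⟩
  continuous_toFun := by fun_prop
  source' := by ext; simp
  target' := by ext; simp

theorem segmentPath_mem {N : Set ℂ} (a b : N) (h : segment ℝ (a : ℂ) b ⊆ N) {C : Set ℂ}
    (hC : Convex ℝ C) (ha : (a : ℂ) ∈ C) (hb : (b : ℂ) ∈ C) (s) :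
    (segmentPath a b h s : ℂ) ∈ C :=
  hC.segment_subset ha hb (by rw [← Path.range_segment]; exact ⟨s, rfl⟩)

/-- If a filled set `N` contains the top and left sides of a square and these are joined, outside of
the strip above the square, by a connected subset of `N`, then `N` contains the square. -/
theorem square_subset_of_logHull_subset {N R : Set ℂ} (hN : IsClosed N) (hNN : logHull N ⊆ N)
    (hR : IsClosed R) (hRc : IsPreconnected R) (hRN : R ⊆ N) {x₀ x₁ y₀ y₁ : ℝ} (hx : x₀ < x₁)
    (hy : y₀ < y₁) (ht : Set.Icc x₀ x₁ ×ℂ {y₁} ⊆ N) (hl : {x₀} ×ℂ Set.Icc y₀ y₁ ⊆ N)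
    (h1 : (⟨x₁, y₁⟩ : ℂ) ∈ R) (h2 : (⟨x₀, y₀⟩ : ℂ) ∈ R)
    (hs : ∀ z ∈ R, z.re ∈ Set.Ioo x₀ x₁ → z.im ≤ y₀) :
    Set.Icc x₀ x₁ ×ℂ Set.Icc y₀ y₁ ⊆ N := by
  have hcl : closure (Set.Ioo x₀ x₁ ×ℂ Set.Ioo y₀ y₁) = Set.Icc x₀ x₁ ×ℂ Set.Icc y₀ y₁ := by
    rw [Complex.closure_reProdIm, closure_Ioo hx.ne, closure_Ioo hy.ne]
  rw [← hcl]
  refine closure_minimal (fun q hq => ?_) hN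
  by_contra hqN
  have hlog : HasLog N (fun z => z - q) := not_not.1 fun hh => hqN (hNN hh)
  obtain ⟨⟨hq1, hq2⟩, hq3, hq4⟩ := hq
  have hc : ∀ {s t : Set ℝ}, IsClosed s → IsClosed t → IsClosed (s ×ℂ t) := fun hs ht =>
    (hs.preimage Complex.continuous_re).inter (ht.preimage Complex.continuous_im)
  let E : Set ℂ := Set.Icc x₀ x₁ ×ℂ {y₁} ∪ {x₀} ×ℂ Set.Icc y₀ y₁
  let E' : Set ℂ := Set.Icc x₀ x₁ ×ℂ {y₀} ∪ {x₁} ×ℂ Set.Icc y₀ y₁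
  have hE : IsClosed E := (hc isClosed_Icc isClosed_singleton).union
    (hc isClosed_singleton isClosed_Icc)
  have hE' : IsClosed E' := (hc isClosed_Icc isClosed_singleton).union
    (hc isClosed_singleton isClosed_Icc)
  have hA : HasLog (R ∪ E) (fun z => z - q) :=
    hlog.mono (Set.union_subset hRN (Set.union_subset ht hl))
  have hB : HasLog (R ∪ E') (fun z => z - q) := by
    -- The factor `I` turns the upward ray from `q` into the slit of the logarithm. The bottom and
    -- right sides miss this ray, and so does `R` by `hs`.
    have hB1 : HasLog (R ∪ E') (fun z => (z - q) * Complex.I) := by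
      refine hasLog_of_mem_slitPlane (by fun_prop) fun z hz => ?_
      rw [Complex.mem_slitPlane_iff]
      by_contra! hcon
      obtain ⟨ha, hb⟩ := hcon
      simp only [Complex.mul_re, Complex.mul_im, Complex.sub_re, Complex.sub_im, Complex.I_re,
        Complex.I_im] at ha hb
      have hzr : z.re = q.re := by linarith
      have hzi : q.im ≤ z.im := by linarith
      rcases hz with hz | ⟨⟨hz1, hz2⟩, hz3⟩ | ⟨hz1, hz2⟩
      · have := hs z hz (by rw [hzr]; exact ⟨hq1, hq2⟩)
        linarith
      · have : z.im = y₀ := hz3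
        linarith
      · have : z.re = x₁ := hz1
        linarith
    refine (hB1.mul (hasLog_const _ (neg_ne_zero.2 Complex.I_ne_zero))).congr fun z _ => ?_
    linear_combination (-(z - q)) * Complex.I_mul_I
  -- The sides in `E` and those in `E'` meet only at two corners, both in `R`; so the two logarithms
  -- are glued along the connected set `R`.
  have hint : (R ∪ E) ∩ (R ∪ E') = R := by
    rw [← Set.union_inter_distrib_left, Set.union_eq_left]
    rintro ⟨a, b⟩ ⟨hz, hz'⟩
    rcases hz with ⟨⟨hz1, hz2⟩, hz3⟩ | ⟨hz1, ⟨hz2, hz3⟩⟩ <;>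
    rcases hz' with ⟨⟨hz1', hz2'⟩, hz3'⟩ | ⟨hz1', ⟨hz2', hz3'⟩⟩ <;>
    simp only [Set.mem_preimage, Set.mem_singleton_iff] at * <;> subst_vars
    · exact absurd rfl hy.ne
    · exact h1
    · exact h2
    · exact absurd rfl hx.ne
  have hU := hA.union (hR.union hE) (hR.union hE') (by rw [hint]; exact hRc) hB
  have hUo : IsOpen (Set.Ioo x₀ x₁ ×ℂ Set.Ioo y₀ y₁) := isOpen_Ioo.reProdIm isOpen_Ioo
  have hUb : Bornology.IsBounded (Set.Ioo x₀ x₁ ×ℂ Set.Ioo y₀ y₁) :=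
    (Metric.isBounded_Ioo _ _).reProdIm (Metric.isBounded_Ioo _ _)
  refine subset_logHull_frontier hUo hUb ⟨⟨hq1, hq2⟩, hq3, hq4⟩ (hU.mono ?_)
  rw [Complex.frontier_reProdIm, closure_Ioo hx.ne, closure_Ioo hy.ne, frontier_Ioo hx,
    frontier_Ioo hy]
  rintro z (⟨hz1, hz2 | hz2⟩ | ⟨hz1 | hz1, hz2⟩)
  · exact Or.inr (Or.inr (Or.inl ⟨hz1, hz2⟩))
  · exact Or.inl (Or.inr (Or.inl ⟨hz1, hz2⟩))
  · exact Or.inl (Or.inr (Or.inr ⟨hz1, hz2⟩))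
  · exact Or.inr (Or.inr (Or.inr ⟨hz1, hz2⟩))

/-! ### Lattice walks and their classes in the fundamental groupoid. -/

section Lattice

open CategoryTheory

/-- The homotopy class of a path, as a morphism of the fundamental groupoid. -/
def pathClass {X : Type*} [TopologicalSpace X] {a b : X} (p : Path a b) :
    (⟨a⟩ : FundamentalGroupoid X) ⟶ ⟨b⟩ :=
  Path.Homotopic.Quotient.mk p

theorem pathClass_trans {X : Type*} [TopologicalSpace X] {a b c : X} (p : Path a b)
    (q : Path b c) : pathClass (p.trans q) = pathClass p ≫ pathClass q := rfl

theorem pathClass_eq_iff {X : Type*} [TopologicalSpace X] {a b : X} {p q : Path a b} :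
    pathClass p = pathClass q ↔ p.Homotopic q :=
  Path.Homotopic.Quotient.eq

/-- The homotopy class in `N` of a straight path. -/
noncomputable def edgeClass {N : Set ℂ} (a b : N) (h : segment ℝ (a : ℂ) b ⊆ N) :
    (⟨a⟩ : FundamentalGroupoid N) ⟶ ⟨b⟩ :=
  pathClass (segmentPath a b h)

theorem edgeClass_comp_eq {N C : Set ℂ} (hC : Convex ℝ C) (hCN : C ⊆ N) {a b v w : N}
    (ha : (a : ℂ) ∈ C) (hb : (b : ℂ) ∈ C) (hv : (v : ℂ) ∈ C) (hw : (w : ℂ) ∈ C)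
    (h1 : segment ℝ (a : ℂ) v ⊆ N) (h2 : segment ℝ (v : ℂ) b ⊆ N)
    (h3 : segment ℝ (a : ℂ) w ⊆ N) (h4 : segment ℝ (w : ℂ) b ⊆ N) :
    edgeClass a v h1 ≫ edgeClass v b h2 = edgeClass a w h3 ≫ edgeClass w b h4 := by
  have key : ∀ {u : N} (h1 : segment ℝ (a : ℂ) u ⊆ N) (h2 : segment ℝ (u : ℂ) b ⊆ N),
      (u : ℂ) ∈ C → ∀ s, ((segmentPath a u h1).trans (segmentPath u b h2) s : ℂ) ∈ C := by
    intro u h1 h2 hu s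
    rw [Path.trans_apply]
    split_ifs
    · exact segmentPath_mem _ _ _ hC ha hu _
    · exact segmentPath_mem _ _ _ hC hu hb _
  exact Path.Homotopic.Quotient.eq.2
    (Path.homotopic_of_convex _ _ hC hCN (key h1 h2 hv) (key h3 h4 hw))

theorem edgeClass_comp_symm {N : Set ℂ} (a b : N) (h : segment ℝ (a : ℂ) b ⊆ N)
    (h' : segment ℝ (b : ℂ) a ⊆ N) : edgeClass a b h ≫ edgeClass b a h' = 𝟙 _ := by
  refine Path.Homotopic.Quotient.eq.2 (Path.homotopic_of_convex _ (Path.refl a)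
    (convex_segment (a : ℂ) b) h (fun s => ?_) fun s => left_mem_segment ℝ _ _)
  rw [Path.trans_apply]
  split_ifs
  · exact segmentPath_mem _ _ _ (convex_segment _ _) (left_mem_segment _ _ _)
      (right_mem_segment _ _ _) _
  · exact segmentPath_mem _ _ _ (convex_segment _ _) (right_mem_segment _ _ _)
      (left_mem_segment _ _ _) _

/-- The point of the square lattice of mesh `h` with integer coordinates `u`. -/
def latticePoint (h : ℝ) (u : ℤ × ℤ) : ℂ := ⟨h * u.1, h * u.2⟩

/-- The graph of lattice points in `N`, neighbours being joined if the segment between them is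
contained in `N`. -/
def latticeGraph (N : Set ℂ) (h : ℝ) : SimpleGraph {u : ℤ × ℤ // latticePoint h u ∈ N} where
  Adj u v := (u.1.1 - v.1.1).natAbs + (u.1.2 - v.1.2).natAbs = 1 ∧
    segment ℝ (latticePoint h u) (latticePoint h v) ⊆ N
  symm := ⟨fun u v huv => ⟨by have := huv.1; omega, by rw [segment_symm]; exact huv.2⟩⟩
  loopless := ⟨fun u hu => by have := hu.1; simp at this⟩

variable {N : Set ℂ} {h : ℝ}

/-- A lattice point of `N` as an object of the fundamental groupoid of `N`. -/
abbrev latticeObj (u : {u : ℤ × ℤ // latticePoint h u ∈ N}) : FundamentalGroupoid N :=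
  ⟨⟨latticePoint h u, u.2⟩⟩

/-- The homotopy class in `N` of an edge of the lattice. -/
noncomputable def latticeEdge {u v : {u : ℤ × ℤ // latticePoint h u ∈ N}}
    (huv : (latticeGraph N h).Adj u v) : (latticeObj u : FundamentalGroupoid N) ⟶ latticeObj v :=
  edgeClass ⟨latticePoint h u, u.2⟩ ⟨latticePoint h v, v.2⟩ huv.2

theorem latticeEdge_comp_symm {u v : {u : ℤ × ℤ // latticePoint h u ∈ N}}
    (huv : (latticeGraph N h).Adj u v) (hvu : (latticeGraph N h).Adj v u) :
    latticeEdge huv ≫ latticeEdge hvu = 𝟙 _ :=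
  edgeClass_comp_symm _ _ _ _

theorem latticeEdge_square {C : Set ℂ} (hC : Convex ℝ C) (hCN : C ⊆ N)
    {a b v w : {u : ℤ × ℤ // latticePoint h u ∈ N}} (ha : latticePoint h a ∈ C)
    (hb : latticePoint h b ∈ C) (hv : latticePoint h v ∈ C) (hw : latticePoint h w ∈ C)
    (h1 : (latticeGraph N h).Adj a v) (h2 : (latticeGraph N h).Adj v b)
    (h3 : (latticeGraph N h).Adj a w) (h4 : (latticeGraph N h).Adj w b) :
    latticeEdge h1 ≫ latticeEdge h2 = latticeEdge h3 ≫ latticeEdge h4 :=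
  edgeClass_comp_eq hC hCN ha hb hv hw _ _ _ _

/-- The homotopy class in `N` of a lattice walk. -/
noncomputable def walkClass : ∀ {u v : {u : ℤ × ℤ // latticePoint h u ∈ N}},
    (latticeGraph N h).Walk u v →
      ((latticeObj u : FundamentalGroupoid N) ⟶ latticeObj v)
  | _, _, .nil => 𝟙 _
  | _, _, .cons huv p => latticeEdge huv ≫ walkClass p

theorem walkClass_append {u v w : {u : ℤ × ℤ // latticePoint h u ∈ N}}
    (p : (latticeGraph N h).Walk u v) (q : (latticeGraph N h).Walk v w) :
    walkClass (p.append q) = walkClass p ≫ walkClass q := by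
  induction p with
  | nil => simp [walkClass]
  | cons huv p ih => simp [walkClass, ih]

/-- A size of lattice walks in the half plane above `y₀` that grows with length and height. -/
def walkSize (y₀ : ℤ) : ∀ {u v : {u : ℤ × ℤ // latticePoint h u ∈ N}},
    (latticeGraph N h).Walk u v → ℕ
  | _, _, .nil => 0
  -- The initial vertex is not counted, so for a closed walk the size does not depend on the base
  -- point.
  | _, _, .cons (v := v) _ p => (v.1.2 - y₀).toNat + 1 + walkSize y₀ p

theorem walkSize_append (y₀ : ℤ) {u v w : {u : ℤ × ℤ // latticePoint h u ∈ N}}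
    (p : (latticeGraph N h).Walk u v) (q : (latticeGraph N h).Walk v w) :
    walkSize y₀ (p.append q) = walkSize y₀ p + walkSize y₀ q := by
  induction p with
  | nil => simp [walkSize]
  | cons huv p ih => simp [walkSize, ih, add_assoc]

/-- The subset of the plane covered by a lattice walk. -/
def walkTrace : ∀ {u v : {u : ℤ × ℤ // latticePoint h u ∈ N}},
    (latticeGraph N h).Walk u v → Set ℂ
  | u, _, .nil => {latticePoint h u}
  | u, _, .cons (v := v) _ p => segment ℝ (latticePoint h u) (latticePoint h v) ∪ walkTrace p

theorem start_mem_walkTrace {u v : {u : ℤ × ℤ // latticePoint h u ∈ N}}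
    (p : (latticeGraph N h).Walk u v) : latticePoint h u ∈ walkTrace p := by
  cases p with
  | nil => exact rfl
  | cons huv p => exact Or.inl (left_mem_segment _ _ _)

theorem end_mem_walkTrace {u v : {u : ℤ × ℤ // latticePoint h u ∈ N}}
    (p : (latticeGraph N h).Walk u v) : latticePoint h v ∈ walkTrace p := by
  induction p with
  | nil => exact rfl
  | cons huv p ih => exact Or.inr ih

theorem isClosed_walkTrace {u v : {u : ℤ × ℤ // latticePoint h u ∈ N}}
    (p : (latticeGraph N h).Walk u v) : IsClosed (walkTrace p) := by
  induction p with
  | nil => exact isClosed_singleton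
  | cons huv p ih =>
    refine IsClosed.union ?_ ih
    rw [← Path.range_segment]
    exact (isCompact_range (Path.continuous _)).isClosed

theorem isPreconnected_walkTrace {u v : {u : ℤ × ℤ // latticePoint h u ∈ N}}
    (p : (latticeGraph N h).Walk u v) : IsPreconnected (walkTrace p) := by
  induction p with
  | nil => exact isPreconnected_singleton
  | cons huv p ih =>
    exact (convex_segment _ _).isPreconnected.union _ (right_mem_segment _ _ _)
      (start_mem_walkTrace p) ih

theorem walkTrace_subset {u v : {u : ℤ × ℤ // latticePoint h u ∈ N}}
    (p : (latticeGraph N h).Walk u v) : walkTrace p ⊆ N := by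
  induction p with
  | @nil u => exact Set.singleton_subset_iff.2 u.2
  | cons huv p ih => exact Set.union_subset huv.2 ih

/-- Over the open column from `x` to `x + 1` there are only horizontal edges, and one in the row `y`
would have to start at `x + 1` or further right. -/
theorem latticePoint_segment_strip (hh : 0 < h) {u v : ℤ × ℤ}
    (huv : (u.1 - v.1).natAbs + (u.2 - v.2).natAbs = 1) {x y : ℤ}
    (hu : u.2 < y ∨ u.2 = y ∧ x < u.1) (hv : v.2 < y ∨ v.2 = y ∧ x < v.1) {z : ℂ}
    (hz : z ∈ segment ℝ (latticePoint h u) (latticePoint h v))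
    (hzs : z.re ∈ Set.Ioo (h * x) (h * (x + 1))) : z.im ≤ h * (y - 1) := by
  obtain ⟨s, t, hs, ht, hst, rfl⟩ := hz
  simp only [latticePoint, Complex.add_re, Complex.real_smul, Complex.mul_re, Complex.ofReal_re,
    Complex.ofReal_im, zero_mul, sub_zero, Set.mem_Ioo, Complex.add_im, Complex.mul_im,
    add_zero] at hzs ⊢
  have hs' : s = 1 - t := by linarith
  subst hs'
  have e1 : (1 - t) * (h * (u.1 : ℝ)) + t * (h * v.1) = h * ((1 - t) * u.1 + t * v.1) := by ring
  have e2 : (1 - t) * (h * (u.2 : ℝ)) + t * (h * v.2) = h * ((1 - t) * u.2 + t * v.2) := by ring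
  rw [e1, mul_lt_mul_iff_right₀ hh, mul_lt_mul_iff_right₀ hh] at hzs
  rw [e2, mul_le_mul_iff_right₀ hh]
  obtain ⟨hz1, hz2⟩ := hzs
  by_cases hxx : u.1 = v.1
  · rw [hxx] at hz1 hz2
    have hz1' : (x : ℝ) < v.1 := by linarith
    have hz2' : (v.1 : ℝ) < x + 1 := by linarith
    have : x < v.1 := by exact_mod_cast hz1'
    have : v.1 < x + 1 := by exact_mod_cast hz2'
    omega
  · have hyy : u.2 = v.2 := by omega
    rw [hyy]
    have hy : v.2 < y := by
      by_contra hcon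
      have hu1 : x + 1 ≤ u.1 := by omega
      have hv1 : x + 1 ≤ v.1 := by omega
      have hu1' : (x : ℝ) + 1 ≤ u.1 := by exact_mod_cast hu1
      have hv1' : (x : ℝ) + 1 ≤ v.1 := by exact_mod_cast hv1
      nlinarith
    have hy' : v.2 ≤ y - 1 := by omega
    have hy'' : (v.2 : ℝ) ≤ y - 1 := by exact_mod_cast hy'
    linarith

theorem walkTrace_strip (hh : 0 < h) {u v : {u : ℤ × ℤ // latticePoint h u ∈ N}}
    (p : (latticeGraph N h).Walk u v) {x y : ℤ}
    (hp : ∀ w ∈ p.support, w.1.2 < y ∨ w.1.2 = y ∧ x < w.1.1) {z : ℂ} (hz : z ∈ walkTrace p)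
    (hzs : z.re ∈ Set.Ioo (h * x) (h * (x + 1))) : z.im ≤ h * (y - 1) := by
  induction p with
  | @nil u =>
    rw [walkTrace, Set.mem_singleton_iff] at hz
    subst hz
    simp only [latticePoint, Set.mem_Ioo, mul_lt_mul_iff_right₀ hh] at hzs
    have h1 : x < u.1.1 := by exact_mod_cast hzs.1
    have h2 : u.1.1 < x + 1 := by exact_mod_cast hzs.2
    omega
  | @cons u v w huv p ih =>
    rcases hz with hz | hz
    · exact latticePoint_segment_strip hh huv.1 (hp u (by simp)) (hp v (by simp)) hz hzs
    · exact ih (fun w hw => hp w (by simp [hw])) hz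

end Lattice

/-! ### Contracting closed lattice walks in filled sets. -/

section Lattice

open CategoryTheory

variable {N : Set ℂ} {h : ℝ}

theorem exists_topLeft {u v : {u : ℤ × ℤ // latticePoint h u ∈ N}}
    (p : (latticeGraph N h).Walk u v) :
    ∃ w ∈ p.support, ∀ w' ∈ p.support, w'.1.2 < w.1.2 ∨ w'.1.2 = w.1.2 ∧ w.1.1 ≤ w'.1.1 := by
  classical
  obtain ⟨w, hw, hmax⟩ := p.support.toFinset.exists_max_image
    (fun w => toLex (w.1.2, -w.1.1)) ⟨u, by simp⟩
  refine ⟨w, by simpa using hw, fun w' hw' => ?_⟩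
  have := hmax w' (by simpa using hw')
  rw [Prod.Lex.le_iff] at this
  simp only [ofLex_toLex] at this
  omega

theorem Icc_reProdIm_singleton_subset_segment {x₀ x₁ y : ℝ} (hx : x₀ ≤ x₁) :
    Set.Icc x₀ x₁ ×ℂ {y} ⊆ segment ℝ (⟨x₀, y⟩ : ℂ) ⟨x₁, y⟩ := by
  rintro ⟨a, b⟩ ⟨ha, hb⟩
  rw [← segment_eq_Icc hx] at ha
  obtain ⟨s, t, hs, ht, hst, hsum⟩ := ha
  have hb : b = y := hb
  refine ⟨s, t, hs, ht, hst, ?_⟩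
  apply Complex.ext
  · simpa using hsum
  · simp [hb, ← add_mul, hst]

theorem singleton_reProdIm_Icc_subset_segment {x y₀ y₁ : ℝ} (hy : y₀ ≤ y₁) :
    {x} ×ℂ Set.Icc y₀ y₁ ⊆ segment ℝ (⟨x, y₀⟩ : ℂ) ⟨x, y₁⟩ := by
  rintro ⟨a, b⟩ ⟨ha, hb⟩
  rw [← segment_eq_Icc hy] at hb
  obtain ⟨s, t, hs, ht, hst, hsum⟩ := hb
  have ha : a = x := ha
  refine ⟨s, t, hs, ht, hst, ?_⟩
  apply Complex.ext
  · simp [ha, ← add_mul, hst]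
  · simpa using hsum

/-- If a closed walk in a filled set turns around its top left vertex `v`, then the corner square
at `v` is in the set. -/
theorem corner_square_subset (hh : 0 < h) (hN : IsClosed N) (hNN : logHull N ⊆ N)
    {v r d a b : {u : ℤ × ℤ // latticePoint h u ∈ N}} (q : (latticeGraph N h).Walk a b)
    (hq : ∀ w ∈ q.support, w.1.2 < v.1.2 ∨ w.1.2 = v.1.2 ∧ v.1.1 < w.1.1)
    (hr : r.1 = (v.1.1 + 1, v.1.2)) (hd : d.1 = (v.1.1, v.1.2 - 1))
    (hvr : (latticeGraph N h).Adj v r) (hvd : (latticeGraph N h).Adj v d)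
    (hrq : latticePoint h r ∈ walkTrace q) (hdq : latticePoint h d ∈ walkTrace q) :
    Set.Icc (h * v.1.1) (h * (v.1.1 + 1)) ×ℂ Set.Icc (h * (v.1.2 - 1)) (h * v.1.2) ⊆ N := by
  have er : latticePoint h r = ⟨h * (v.1.1 + 1), h * v.1.2⟩ := by simp [latticePoint, hr]
  have ed : latticePoint h d = ⟨h * v.1.1, h * (v.1.2 - 1)⟩ := by simp [latticePoint, hd]
  have hx : h * (v.1.1 : ℝ) < h * (v.1.1 + 1) := by nlinarith
  have hy : h * ((v.1.2 : ℝ) - 1) < h * v.1.2 := by nlinarith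
  refine square_subset_of_logHull_subset hN hNN (isClosed_walkTrace q)
    (isPreconnected_walkTrace q) (walkTrace_subset q) hx hy ?_ ?_ (er ▸ hrq) (ed ▸ hdq)
    fun z hz hzs => walkTrace_strip hh q hq hz hzs
  · have := hvr.2
    rw [er] at this
    exact (Icc_reProdIm_singleton_subset_segment hx.le).trans this
  · have := hvd.2
    rw [ed, segment_symm] at this
    exact (singleton_reProdIm_Icc_subset_segment hy.le).trans this

/-- Closed lattice walks in a filled set are null-homotopic. -/
theorem walkClass_eq_id_of_size (hh : 0 < h) (hN : IsClosed N) (hNN : logHull N ⊆ N) (y₀ : ℤ)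
    (n : ℕ) : ∀ (u : {u : ℤ × ℤ // latticePoint h u ∈ N}) (c : (latticeGraph N h).Walk u u),
      (∀ w ∈ c.support, y₀ ≤ w.1.2) → walkSize y₀ c = n → walkClass c = 𝟙 _ := by
  classical
  induction n using Nat.strong_induction_on with
  | _ n ih =>
  -- Rotating a closed walk keeps its size and only conjugates its class, so it may start at its top
  -- left vertex.
  suffices key : ∀ (v : {u : ℤ × ℤ // latticePoint h u ∈ N}) (c : (latticeGraph N h).Walk v v),
      (∀ w ∈ c.support, y₀ ≤ w.1.2) → walkSize y₀ c = n →
      (∀ w ∈ c.support, w.1.2 < v.1.2 ∨ w.1.2 = v.1.2 ∧ v.1.1 ≤ w.1.1) → walkClass c = 𝟙 _ by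
    intro u c hc hn
    obtain ⟨v, hv, hmax⟩ := exists_topLeft c
    have hspec := c.take_spec hv
    set p := c.takeUntil v hv
    set q := c.dropUntil v hv
    have hsupp : ∀ w ∈ (q.append p).support, w ∈ c.support := by
      intro w hw
      rw [← hspec, SimpleGraph.Walk.mem_support_append_iff]
      rw [SimpleGraph.Walk.mem_support_append_iff] at hw
      exact hw.symm
    have hqp := key v (q.append p) (fun w hw => hc w (hsupp w hw))
      (by rw [← hn, ← hspec, walkSize_append, walkSize_append, add_comm])
      (fun w hw => hmax w (hsupp w hw))
    rw [walkClass_append] at hqp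
    rw [← hspec, walkClass_append, ← cancel_epi (walkClass q), ← Category.assoc, hqp]
    simp
  intro v c hc hn htop
  cases c with
  | nil => rfl
  | @cons _ a _ hva p =>
  cases p with
  | nil => exact absurd rfl hva.ne
  | cons hva' p' =>
  obtain ⟨b, q, hbv, hq⟩ := SimpleGraph.Walk.exists_cons_eq_concat hva' p'
  rw [hq, SimpleGraph.Walk.concat_eq_append] at hn hc htop ⊢
  have hsup : ∀ w ∈ q.support, w ∈ (SimpleGraph.Walk.cons hva (q.append (.cons hbv .nil))).support :=
    fun w hw => by simp [SimpleGraph.Walk.mem_support_append_iff, hw]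
  -- If the walk revisits `v` on the way, it splits into two smaller loops.
  by_cases hvq : v ∈ q.support
  · have hspec := q.take_spec hvq
    set q₁ := q.takeUntil v hvq
    set q₂ := q.dropUntil v hvq
    have hs1 : ∀ w ∈ q₁.support, w ∈ q.support := fun w hw => by
      rw [← hspec, SimpleGraph.Walk.mem_support_append_iff]; exact Or.inl hw
    have hs2 : ∀ w ∈ q₂.support, w ∈ q.support := fun w hw => by
      rw [← hspec, SimpleGraph.Walk.mem_support_append_iff]; exact Or.inr hw
    have hvc := hc v (by simp)
    rw [← hspec] at hn ⊢
    simp only [walkSize, walkSize_append] at hn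
    have h1 := ih _ (by rw [← hn]; simp only [walkSize]; omega) v (.cons hva q₁) (fun w hw => by
      rw [SimpleGraph.Walk.support_cons, List.mem_cons] at hw
      rcases hw with rfl | hw
      · exact hvc
      · exact hc w (hsup w (hs1 w hw))) rfl
    have h2 := ih _ (by rw [← hn]; simp only [walkSize, walkSize_append]; omega) v
      (q₂.append (.cons hbv .nil)) (fun w hw => by
        rw [SimpleGraph.Walk.mem_support_append_iff] at hw
        rcases hw with hw | hw
        · exact hc w (hsup w (hs2 w hw))
        · simp only [SimpleGraph.Walk.support_cons, SimpleGraph.Walk.support_nil, List.mem_cons,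
            List.not_mem_nil, or_false] at hw
          rcases hw with rfl | rfl
          · exact hc _ (hsup _ q.end_mem_support)
          · exact hvc) rfl
    have e : SimpleGraph.Walk.cons hva ((q₁.append q₂).append (.cons hbv .nil)) =
        (SimpleGraph.Walk.cons hva q₁).append (q₂.append (.cons hbv .nil)) := by
      rw [SimpleGraph.Walk.cons_append, SimpleGraph.Walk.append_assoc]
    rw [e, walkClass_append, h1, h2]
    simp
  -- If it leaves and re-enters `v` along the same edge, that edge cancels once the loop `q` at `a`
  -- is contracted.
  by_cases hab : a = b
  · subst hab
    simp only [walkSize, walkSize_append] at hn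
    have h1 := ih _ (by rw [← hn]; omega) a q (fun w hw => hc w (hsup w hw)) rfl
    simp only [walkClass, walkClass_append, h1, Category.comp_id, Category.id_comp]
    exact latticeEdge_comp_symm _ _
  have hq' : ∀ w ∈ q.support, w.1.2 < v.1.2 ∨ w.1.2 = v.1.2 ∧ v.1.1 < w.1.1 := by
    intro w hw
    rcases htop w (hsup w hw) with h | ⟨h1, h2⟩
    · exact Or.inl h
    · refine Or.inr ⟨h1, lt_of_le_of_ne h2 fun h3 => hvq ?_⟩
      have : w = v := Subtype.ext (Prod.ext h3.symm h1)
      exact this ▸ hw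
  -- Since `v` is top left, only its right and lower neighbours can occur.
  have hnb : ∀ w ∈ q.support, (latticeGraph N h).Adj v w →
      w.1 = (v.1.1 + 1, v.1.2) ∨ w.1 = (v.1.1, v.1.2 - 1) := by
    intro w hw hvw
    have h1 := hvw.1
    have h2 := hq' w hw
    have : (w.1.1 = v.1.1 + 1 ∧ w.1.2 = v.1.2) ∨ (w.1.1 = v.1.1 ∧ w.1.2 = v.1.2 - 1) := by omega
    rcases this with h | h
    · exact Or.inl (Prod.ext h.1 h.2)
    · exact Or.inr (Prod.ext h.1 h.2)
  have ha := hnb a q.start_mem_support hva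
  have hb := hnb b q.end_mem_support hbv.symm
  have hab' : a.1 ≠ b.1 := fun h => hab (Subtype.ext h)
  -- `walkSize` truncates heights at `y₀`; this bound makes the size really drop when `v` is
  -- lowered.
  have hy : y₀ ≤ v.1.2 - 1 := by
    have h1 := hc a (hsup _ q.start_mem_support)
    have h2 := hc b (hsup _ q.end_mem_support)
    rcases ha with ha | ha <;> rcases hb with hb | hb
    · exact absurd (ha.trans hb.symm) hab'
    · rw [hb] at h2; exact h2
    · rw [ha] at h1; exact h1
    · exact absurd (ha.trans hb.symm) hab'
  have hQ : Set.Icc (h * v.1.1) (h * (v.1.1 + 1)) ×ℂ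
      Set.Icc (h * (v.1.2 - 1)) (h * v.1.2) ⊆ N := by
    rcases ha with ha | ha <;> rcases hb with hb | hb
    · exact absurd (ha.trans hb.symm) hab'
    · exact corner_square_subset hh hN hNN q hq' ha hb hva hbv.symm (start_mem_walkTrace q)
        (end_mem_walkTrace q)
    · exact corner_square_subset hh hN hNN q hq' hb ha hbv.symm hva (end_mem_walkTrace q)
        (start_mem_walkTrace q)
    · exact absurd (ha.trans hb.symm) hab'
  set Q : Set ℂ := Set.Icc (h * v.1.1) (h * (v.1.1 + 1)) ×ℂ
      Set.Icc (h * (v.1.2 - 1)) (h * v.1.2) with hQdef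
  have hQc : Convex ℝ Q :=
    ((convex_Icc _ _).is_linear_preimage Complex.reLm.isLinear).inter
      ((convex_Icc _ _).is_linear_preimage Complex.imLm.isLinear)
  have hmem : ∀ w : ℤ × ℤ, (w.1 = v.1.1 ∨ w.1 = v.1.1 + 1) → (w.2 = v.1.2 ∨ w.2 = v.1.2 - 1) →
      latticePoint h w ∈ Q := by
    rintro ⟨w1, w2⟩ h1 h2
    refine ⟨?_, ?_⟩
    · rcases h1 with h1 | h1 <;> simp only at h1 <;> subst h1 <;>
        simp only [latticePoint, Set.mem_preimage, Set.mem_Icc] <;> push_cast <;>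
        constructor <;> nlinarith
    · rcases h2 with h1 | h1 <;> simp only at h1 <;> subst h1 <;>
        simp only [latticePoint, Set.mem_preimage, Set.mem_Icc] <;> push_cast <;>
        constructor <;> nlinarith
  -- The opposite corner of the square. Rerouting through it instead of `v` lowers one vertex by one
  -- and keeps the length.
  let v' : {u : ℤ × ℤ // latticePoint h u ∈ N} := ⟨(v.1.1 + 1, v.1.2 - 1),
    hQ (hmem _ (Or.inr rfl) (Or.inr rfl))⟩
  have hadj : ∀ w : {u : ℤ × ℤ // latticePoint h u ∈ N},
      w.1 = (v.1.1 + 1, v.1.2) ∨ w.1 = (v.1.1, v.1.2 - 1) →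
      latticePoint h w ∈ Q ∧ (latticeGraph N h).Adj v' w := by
    intro w hw
    have hwQ : latticePoint h w ∈ Q := by
      rcases hw with hw | hw <;> rw [hw] <;> exact hmem _ (by simp) (by simp)
    refine ⟨hwQ, ?_, (hQc.segment_subset (hmem _ (Or.inr rfl) (Or.inr rfl)) hwQ).trans hQ⟩
    rcases hw with hw | hw <;> rw [hw] <;> simp [v']
  obtain ⟨haQ, hav'⟩ := hadj a ha
  obtain ⟨hbQ, hbv'⟩ := hadj b hb
  have hsq := latticeEdge_square hQc hQ haQ hbQ (hmem v.1 (Or.inl rfl) (Or.inl rfl))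
    (hmem v'.1 (Or.inr rfl) (Or.inr rfl)) hva.symm hbv.symm hav'.symm hbv'
  simp only [walkSize, walkSize_append] at hn
  have hc'' := ih _ (by
      rw [← hn]; simp only [walkSize, walkSize_append, v']; omega) v'
    (.cons hav' (q.append (.cons hbv'.symm .nil))) (fun w hw => by
      simp only [SimpleGraph.Walk.support_cons, SimpleGraph.Walk.mem_support_append_iff,
        SimpleGraph.Walk.support_nil, List.mem_cons, List.not_mem_nil, or_false] at hw
      rcases hw with rfl | hw | rfl | rfl
      · exact hy
      · exact hc w (hsup w hw)
      · exact hc _ (hsup _ q.end_mem_support)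
      · exact hy) rfl
  simp only [walkClass, walkClass_append, Category.comp_id] at hc'' ⊢
  have e1 : walkClass q = latticeEdge hav'.symm ≫ latticeEdge hbv' := by
    rw [← cancel_epi (latticeEdge hav'), ← cancel_mono (latticeEdge hbv'.symm)]
    simp only [Category.assoc]
    rw [hc'', latticeEdge_comp_symm, Category.comp_id, latticeEdge_comp_symm]
  rw [e1, ← hsq]
  simp only [Category.assoc]
  rw [latticeEdge_comp_symm, Category.comp_id, latticeEdge_comp_symm]

theorem walkClass_eq_id (hh : 0 < h) (hN : IsClosed N) (hNN : logHull N ⊆ N)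
    {u : {u : ℤ × ℤ // latticePoint h u ∈ N}} (c : (latticeGraph N h).Walk u u) :
    walkClass c = 𝟙 _ := by
  classical
  obtain ⟨w, -, hmin⟩ := c.support.toFinset.exists_min_image (fun w => w.1.2) ⟨u, by simp⟩
  exact walkClass_eq_id_of_size hh hN hNN w.1.2 _ u c (fun w' hw' => hmin w' (by simpa using hw'))
    rfl

end Lattice

/-! ### Approximating paths by lattice walks. -/

section Lattice

open CategoryTheory

variable {N : Set ℂ} {h : ℝ}

theorem exists_path_walkClass {C : Set ℂ} (hC : Convex ℝ C)
    {u v : {u : ℤ × ℤ // latticePoint h u ∈ N}} (w : (latticeGraph N h).Walk u v)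
    (hw : ∀ x ∈ w.support, latticePoint h x ∈ C) :
    ∃ P : Path (⟨latticePoint h u, u.2⟩ : N) ⟨latticePoint h v, v.2⟩,
      walkClass w = pathClass P ∧ ∀ s, (P s : ℂ) ∈ C := by
  induction w with
  | @nil u => exact ⟨Path.refl _, rfl, fun s => hw u (by simp)⟩
  | @cons u v _ huv p ih =>
    obtain ⟨P, hP, hPC⟩ := ih (fun x hx => hw x (by simp [hx]))
    refine ⟨(segmentPath _ _ huv.2).trans P, ?_, fun s => ?_⟩
    · rw [walkClass, hP]; rfl
    · rw [Path.trans_apply]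
      split_ifs
      · exact segmentPath_mem _ _ _ hC (hw u (by simp)) (hw v (by simp)) _
      · exact hPC _

theorem pathClass_eq_of_convex {C : Set ℂ} (hC : Convex ℝ C) (hCN : C ⊆ N) {a b u v : N}
    (p : Path a b) (hau : segment ℝ (a : ℂ) u ⊆ N) (hvb : segment ℝ (v : ℂ) b ⊆ N) (P : Path u v)
    (hp : ∀ s, (p s : ℂ) ∈ C) (hu : (u : ℂ) ∈ C) (hv : (v : ℂ) ∈ C) (hP : ∀ s, (P s : ℂ) ∈ C) :
    pathClass p = edgeClass a u hau ≫ pathClass P ≫ edgeClass v b hvb := by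
  simp only [edgeClass, ← pathClass_trans]
  refine pathClass_eq_iff.2 (Path.homotopic_of_convex _ _ hC hCN hp fun s => ?_)
  rw [Path.trans_apply]
  split_ifs
  · exact segmentPath_mem _ _ _ hC (by simpa using hp 0) hu _
  · rw [Path.trans_apply]
    split_ifs
    · exact hP _
    · exact segmentPath_mem _ _ _ hC hv (by simpa using hp 1) _

theorem pathClass_eq_walkClass {C : Set ℂ} (hC : Convex ℝ C) (hCN : C ⊆ N) {a b : N}
    {u v : {u : ℤ × ℤ // latticePoint h u ∈ N}} (w : (latticeGraph N h).Walk u v)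
    (hw : ∀ x ∈ w.support, latticePoint h x ∈ C) (p : Path a b) (hp : ∀ s, (p s : ℂ) ∈ C)
    (hau : segment ℝ (a : ℂ) (latticePoint h u) ⊆ N)
    (hvb : segment ℝ (latticePoint h v) (b : ℂ) ⊆ N) :
    pathClass p = edgeClass a ⟨latticePoint h u, u.2⟩ hau ≫ walkClass w ≫
      edgeClass ⟨latticePoint h v, v.2⟩ b hvb := by
  obtain ⟨P, hP, hPC⟩ := exists_path_walkClass hC w hw
  rw [hP]
  exact pathClass_eq_of_convex hC hCN p hau hvb P hp (hw _ w.start_mem_support)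
    (hw _ w.end_mem_support) hPC

theorem exists_walk_of_natAbs_le {C : Set ℂ} (hC : Convex ℝ C) (hCN : C ⊆ N)
    {u v : {u : ℤ × ℤ // latticePoint h u ∈ N}} (hu : latticePoint h u ∈ C)
    (hv : latticePoint h v ∈ C)
    (huv : (u.1.1 - v.1.1).natAbs + (u.1.2 - v.1.2).natAbs ≤ 1) :
    ∃ w : (latticeGraph N h).Walk u v, ∀ x ∈ w.support, latticePoint h x ∈ C := by
  by_cases h1 : (u.1.1 - v.1.1).natAbs + (u.1.2 - v.1.2).natAbs = 1
  · have hadj : (latticeGraph N h).Adj u v := ⟨h1, (hC.segment_subset hu hv).trans hCN⟩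
    refine ⟨.cons hadj .nil, fun x hx => ?_⟩
    simp only [SimpleGraph.Walk.support_cons, SimpleGraph.Walk.support_nil, List.mem_cons,
      List.not_mem_nil, or_false] at hx
    rcases hx with rfl | rfl <;> assumption
  · have : u = v := Subtype.ext (Prod.ext (by omega) (by omega))
    subst this
    refine ⟨.nil, fun x hx => ?_⟩
    rw [SimpleGraph.Walk.support_nil, List.mem_singleton] at hx
    rwa [hx]

/-- The lower left corner of the lattice square that contains `z`. -/
noncomputable def latticeFloor (h : ℝ) (z : ℂ) : ℤ × ℤ := (⌊z.re / h⌋, ⌊z.im / h⌋)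

theorem abs_mul_floor_div_sub_le (hh : 0 < h) (x : ℝ) : |h * ⌊x / h⌋ - x| ≤ h := by
  have h1 := Int.floor_le (x / h)
  have h2 := (Int.lt_floor_add_one (x / h)).le
  rw [le_div_iff₀ hh] at h1
  rw [div_le_iff₀ hh] at h2
  rw [abs_le]; constructor <;> linarith

theorem natAbs_floor_sub_floor_le (hh : 0 < h) {x y : ℝ} (hxy : |x - y| ≤ h) :
    (⌊x / h⌋ - ⌊y / h⌋).natAbs ≤ 1 := by
  rw [abs_le] at hxy
  have h1 : y / h ≤ x / h + 1 := by
    rw [div_add_one hh.ne', div_le_div_iff_of_pos_right hh]; linarith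
  have h2 : x / h ≤ y / h + 1 := by
    rw [div_add_one hh.ne', div_le_div_iff_of_pos_right hh]; linarith
  have h3 := Int.floor_le_floor h1
  have h4 := Int.floor_le_floor h2
  rw [Int.floor_add_one] at h3 h4
  omega

theorem norm_latticePoint_sub_le (u : ℤ × ℤ) (z : ℂ) {c d : ℝ} (h1 : |h * u.1 - z.re| ≤ c)
    (h2 : |h * u.2 - z.im| ≤ d) : dist (latticePoint h u) z ≤ c + d := by
  rw [dist_eq_norm]
  exact (Complex.norm_le_abs_re_add_abs_im _).trans (add_le_add h1 h2)

variable {K : Set ℂ}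

theorem latticePoint_latticeFloor_mem (hh : 0 < h) (hKN : Metric.cthickening (3 * h) K ⊆ N) {z : ℂ}
    (hz : z ∈ K) : latticePoint h (latticeFloor h z) ∈ N := by
  refine hKN (Metric.mem_cthickening_of_dist_le _ z _ _ hz ?_)
  have := norm_latticePoint_sub_le (latticeFloor h z) z (abs_mul_floor_div_sub_le hh _)
    (abs_mul_floor_div_sub_le hh _)
  linarith

theorem segment_latticeFloor_subset (hh : 0 < h) (hKN : Metric.cthickening (3 * h) K ⊆ N) {z : ℂ}
    (hz : z ∈ K) : segment ℝ z (latticePoint h (latticeFloor h z)) ⊆ N := by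
  refine Set.Subset.trans ?_ ((Metric.closedBall_subset_cthickening hz _).trans hKN)
  refine (convex_closedBall z (3 * h)).segment_subset (Metric.mem_closedBall_self (by positivity)) ?_
  have := norm_latticePoint_sub_le (latticeFloor h z) z (abs_mul_floor_div_sub_le hh _)
    (abs_mul_floor_div_sub_le hh _)
  rw [Metric.mem_closedBall]
  linarith

/-- Each coordinate of the floor changes by at most one, so an L-shaped walk suffices. The radius `3
* h` allows `h` for the distance of the points and `h` per coordinate for rounding. -/
theorem exists_walk_latticeFloor (hh : 0 < h) (hKN : Metric.cthickening (3 * h) K ⊆ N) {z z' : ℂ}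
    (hz : z ∈ K) (hz' : z' ∈ K) (hzz : dist z' z ≤ h) :
    ∃ w : (latticeGraph N h).Walk ⟨_, latticePoint_latticeFloor_mem hh hKN hz⟩
      ⟨_, latticePoint_latticeFloor_mem hh hKN hz'⟩,
      ∀ x ∈ w.support, latticePoint h x ∈ Metric.closedBall z (3 * h) := by
  have hCN : Metric.closedBall z (3 * h) ⊆ N := (Metric.closedBall_subset_cthickening hz _).trans hKN
  have hre : |z'.re - z.re| ≤ h := by
    have := Complex.abs_re_le_norm (z' - z)
    rw [dist_eq_norm] at hzz
    exact this.trans hzz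
  have him : |z'.im - z.im| ≤ h := by
    have := Complex.abs_im_le_norm (z' - z)
    rw [dist_eq_norm] at hzz
    exact this.trans hzz
  have hre' : |h * (latticeFloor h z').1 - z.re| ≤ 2 * h := by
    have := abs_mul_floor_div_sub_le hh z'.re
    have h2 := abs_sub_le (h * (latticeFloor h z').1) z'.re z.re
    simp only [latticeFloor] at *
    linarith
  have hm1 : latticePoint h (latticeFloor h z) ∈ Metric.closedBall z (3 * h) := by
    have := norm_latticePoint_sub_le (latticeFloor h z) z (abs_mul_floor_div_sub_le hh _)
      (abs_mul_floor_div_sub_le hh _)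
    rw [Metric.mem_closedBall]; linarith
  have hm2 : latticePoint h (latticeFloor h z') ∈ Metric.closedBall z (3 * h) := by
    have := norm_latticePoint_sub_le (latticeFloor h z') z' (abs_mul_floor_div_sub_le hh _)
      (abs_mul_floor_div_sub_le hh _)
    rw [Metric.mem_closedBall]
    have := dist_triangle (latticePoint h (latticeFloor h z')) z' z
    linarith
  have hm3 : latticePoint h ((latticeFloor h z').1, (latticeFloor h z).2) ∈
      Metric.closedBall z (3 * h) := by
    have := norm_latticePoint_sub_le ((latticeFloor h z').1, (latticeFloor h z).2) z hre'
      (abs_mul_floor_div_sub_le hh _)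
    rw [Metric.mem_closedBall]; linarith
  have hc := convex_closedBall z (3 * h)
  obtain ⟨w₁, hw₁⟩ := exists_walk_of_natAbs_le hc hCN
    (u := ⟨_, latticePoint_latticeFloor_mem hh hKN hz⟩)
    (v := ⟨((latticeFloor h z').1, (latticeFloor h z).2), hCN hm3⟩) hm1 hm3 (by
      have := natAbs_floor_sub_floor_le hh hre
      simp only [latticeFloor]; omega)
  obtain ⟨w₂, hw₂⟩ := exists_walk_of_natAbs_le hc hCN
    (u := ⟨((latticeFloor h z').1, (latticeFloor h z).2), hCN hm3⟩)
    (v := ⟨_, latticePoint_latticeFloor_mem hh hKN hz'⟩) hm3 hm2 (by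
      have := natAbs_floor_sub_floor_le hh him
      simp only [latticeFloor]; omega)
  refine ⟨w₁.append w₂, fun x hx => ?_⟩
  rw [SimpleGraph.Walk.mem_support_append_iff] at hx
  exact hx.elim (hw₁ x) (hw₂ x)

/-- The class of a path in `K` is that of a lattice walk, up to segments at the ends. -/
def IsLatticeClass (hh : 0 < h) (hKN : Metric.cthickening (3 * h) K ⊆ N) {a b : N}
    (ha : (a : ℂ) ∈ K) (hb : (b : ℂ) ∈ K) (p : Path a b) : Prop :=
  ∃ w : (latticeGraph N h).Walk ⟨_, latticePoint_latticeFloor_mem hh hKN ha⟩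
      ⟨_, latticePoint_latticeFloor_mem hh hKN hb⟩,
    pathClass p =
      edgeClass a ⟨_, latticePoint_latticeFloor_mem hh hKN ha⟩
        (segment_latticeFloor_subset hh hKN ha) ≫ walkClass w ≫
      edgeClass ⟨_, latticePoint_latticeFloor_mem hh hKN hb⟩ b
        (by rw [segment_symm]; exact segment_latticeFloor_subset hh hKN hb)

theorem isLatticeClass_of_dist_le (hh : 0 < h) (hKN : Metric.cthickening (3 * h) K ⊆ N) {a b : N}
    (ha : (a : ℂ) ∈ K) (hb : (b : ℂ) ∈ K) (p : Path a b) (hp : ∀ s, dist (p s : ℂ) a ≤ h) :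
    IsLatticeClass hh hKN ha hb p := by
  obtain ⟨w, hw⟩ := exists_walk_latticeFloor hh hKN ha hb (by simpa using hp 1)
  refine ⟨w, ?_⟩
  have hCN : Metric.closedBall (a : ℂ) (3 * h) ⊆ N :=
    (Metric.closedBall_subset_cthickening ha _).trans hKN
  have hc := convex_closedBall (a : ℂ) (3 * h)
  exact pathClass_eq_walkClass hc hCN w hw p (fun s => (hp s).trans (by linarith)) _ _

theorem IsLatticeClass.trans {hh : 0 < h} {hKN : Metric.cthickening (3 * h) K ⊆ N} {a b c : N}
    {ha : (a : ℂ) ∈ K} {hb : (b : ℂ) ∈ K} {hc : (c : ℂ) ∈ K} {p : Path a b} {q : Path b c}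
    (hp : IsLatticeClass hh hKN ha hb p) (hq : IsLatticeClass hh hKN hb hc q) :
    IsLatticeClass hh hKN ha hc (p.trans q) := by
  obtain ⟨w, hw⟩ := hp
  obtain ⟨w', hw'⟩ := hq
  refine ⟨w.append w', ?_⟩
  rw [pathClass_trans, hw, hw', walkClass_append]
  have hmid := edgeClass_comp_symm ⟨_, latticePoint_latticeFloor_mem hh hKN hb⟩ b
    (by rw [segment_symm]; exact segment_latticeFloor_subset hh hKN hb)
    (segment_latticeFloor_subset hh hKN hb)
  simp only [Category.assoc]
  -- The detours from the lattice to `b` and back cancel.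
  rw [reassoc_of% hmid]

theorem IsLatticeClass.congr {hh : 0 < h} {hKN : Metric.cthickening (3 * h) K ⊆ N} {a b : N}
    {ha : (a : ℂ) ∈ K} {hb : (b : ℂ) ∈ K} {p q : Path a b} (hp : IsLatticeClass hh hKN ha hb p)
    (hpq : p.Homotopic q) : IsLatticeClass hh hKN ha hb q := by
  obtain ⟨w, hw⟩ := hp
  exact ⟨w, by rw [← hw]; exact pathClass_eq_iff.2 hpq.symm⟩

/-- Cut the path into pieces of oscillation at most `h`; each lies with its lattice walk in one ball
inside `N`, and the pieces concatenate. -/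
theorem isLatticeClass (hh : 0 < h) (hKN : Metric.cthickening (3 * h) K ⊆ N) {a b : N}
    (ha : (a : ℂ) ∈ K) (hb : (b : ℂ) ∈ K) (p : Path a b) (hp : ∀ s, (p s : ℂ) ∈ K) :
    IsLatticeClass hh hKN ha hb p := by
  have huc : UniformContinuous (fun s => (p s : ℂ)) :=
    CompactSpace.uniformContinuous_of_continuous (by fun_prop)
  obtain ⟨ε, hε, hd⟩ := Metric.uniformContinuous_iff.1 huc h hh
  obtain ⟨n, hn⟩ := exists_nat_one_div_lt hε
  have hn0 : (0 : ℝ) < n + 1 := by positivity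
  let t : ℕ → unitInterval := fun k => Set.projIcc 0 1 zero_le_one (k / (n + 1))
  have ht : ∀ k, k ≤ n + 1 → ((t k : unitInterval) : ℝ) = k / (n + 1) := fun k hk => by
    simp only [t]
    rw [Set.projIcc_of_mem zero_le_one ⟨by positivity, ?_⟩]
    rw [div_le_one hn0]; exact_mod_cast hk
  have key : ∀ k, k ≤ n + 1 → IsLatticeClass hh hKN (hp 0) (hp (t k)) (p.subpath 0 (t k)) := by
    intro k
    induction k with
    | zero =>
      intro _
      have h0 : t 0 = 0 := by ext; rw [ht 0 (by omega)]; simp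
      rw [h0]
      refine isLatticeClass_of_dist_le hh hKN _ _ _ fun s => ?_
      simp [hh.le]
    | succ k ih =>
      intro hk
      refine ((ih (by omega)).trans (isLatticeClass_of_dist_le hh hKN (hp (t k)) (hp (t (k + 1)))
        (p.subpath (t k) (t (k + 1))) fun s => ?_)).congr ⟨Path.Homotopy.subpathTransSubpath p _ _ _⟩
      have hle : t k ≤ t (k + 1) := by
        rw [← Subtype.coe_le_coe, ht k (by omega), ht (k + 1) hk]
        gcongr; simp
      have hs : p.subpath (t k) (t (k + 1)) s ∈ p '' Set.Icc (t k) (t (k + 1)) := by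
        rw [← Path.range_subpath_of_le _ _ _ hle]; exact ⟨s, rfl⟩
      obtain ⟨r, ⟨hr1, hr2⟩, hr⟩ := hs
      rw [← hr]
      refine (hd ?_).le
      rw [Subtype.dist_eq, Real.dist_eq]
      rw [← Subtype.coe_le_coe, ht k (by omega)] at hr1
      rw [← Subtype.coe_le_coe, ht (k + 1) hk] at hr2
      rw [ht k (by omega), abs_of_nonneg (by linarith)]
      refine lt_of_le_of_lt ?_ hn
      push_cast at hr2
      rw [add_div] at hr2
      linarith
  have h1 : t (n + 1) = 1 := by
    ext; rw [ht (n + 1) le_rfl]; push_cast; simp [hn0.ne']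
  have hfin := key (n + 1) le_rfl
  rw [h1, Path.subpath_zero_one] at hfin
  have hcast : ∀ {a' b' : N} (ea : a' = a) (eb : b' = b) (ha' : (a' : ℂ) ∈ K) (hb' : (b' : ℂ) ∈ K),
      IsLatticeClass hh hKN ha' hb' (p.cast ea eb) → IsLatticeClass hh hKN ha hb p := by
    intro a' b' ea eb ha' hb' H
    subst ea eb
    exact H
  exact hcast p.source p.target _ _ hfin

/-- Parallel paths in `K` are homotopic in every filled set that contains a neighbourhood
of `K`. -/
theorem path_homotopic_of_logHull_subset {δ : ℝ} (hδ : 0 < δ) (hKN : Metric.cthickening δ K ⊆ N)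
    (hN : IsClosed N) (hNN : logHull N ⊆ N) {a b : N} (p q : Path a b)
    (hp : ∀ s, (p s : ℂ) ∈ K) (hq : ∀ s, (q s : ℂ) ∈ K) : p.Homotopic q := by
  have hh : 0 < δ / 3 := by positivity
  have hKN' : Metric.cthickening (3 * (δ / 3)) K ⊆ N := by
    rwa [mul_div_cancel₀ _ (by norm_num : (3 : ℝ) ≠ 0)]
  have ha : (a : ℂ) ∈ K := by simpa using hp 0
  have hb : (b : ℂ) ∈ K := by simpa using hp 1
  obtain ⟨w, hw⟩ := isLatticeClass hh hKN' ha hb p hp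
  obtain ⟨w', hw'⟩ := isLatticeClass hh hKN' ha hb q hq
  have h1 := walkClass_eq_id hh hN hNN (w.append w.reverse)
  have h2 := walkClass_eq_id hh hN hNN (w'.append w.reverse)
  have h3 := walkClass_eq_id hh hN hNN (w.reverse.append w)
  rw [walkClass_append] at h1 h2 h3
  have h4 : walkClass w' = walkClass w := by
    calc walkClass w' = walkClass w' ≫ (walkClass w.reverse ≫ walkClass w) := by
          rw [h3, Category.comp_id]
      _ = walkClass w := by rw [← Category.assoc, h2, Category.id_comp]
  refine pathClass_eq_iff.1 (hw.trans (Eq.trans ?_ hw'.symm))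
  rw [h4]

end Lattice

/-! ### Squares in neighbourhoods of a hull. -/

/-- The two ways around a square inside a compact set `K` bound a square in any neighbourhood of
the hull of `K`. -/
theorem exists_square_filler_of_logHull_subset {K U : Set ℂ} (hK : IsCompact K) (hU : IsOpen U)
    (hKU : logHull K ⊆ U) {x₀₀ x₁₀ x₀₁ x₁₁ : ℂ} (b : Path x₀₀ x₁₀) (r : Path x₁₀ x₁₁)
    (l : Path x₀₀ x₀₁) (t : Path x₀₁ x₁₁) (hb : ∀ s, b s ∈ K) (hr : ∀ s, r s ∈ K)
    (hl : ∀ s, l s ∈ K) (ht : ∀ s, t s ∈ K) :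
    ∃ F : C(unitInterval × unitInterval, ℂ), (∀ p, F p ∈ U) ∧ (∀ x, F (x, 0) = b x) ∧
      (∀ x, F (x, 1) = t x) ∧ (∀ y, F (0, y) = l y) ∧ (∀ y, F (1, y) = r y) := by
  obtain ⟨δ, hδ, hN⟩ := exists_logHull_cthickening_subset hK hU hKU
  have hc : IsCompact (Metric.cthickening δ K) := hK.cthickening
  set N := logHull (Metric.cthickening δ K)
  have hKN : K ⊆ N := (Metric.self_subset_cthickening K).trans (subset_logHull _)
  let lift : ∀ {x y : ℂ} (p : Path x y) (hp : ∀ s, p s ∈ K) (hx : x ∈ N) (hy : y ∈ N),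
      Path (⟨x, hx⟩ : N) ⟨y, hy⟩ := fun p hp hx hy =>
    { toFun := fun s => ⟨p s, hKN (hp s)⟩
      continuous_toFun := by fun_prop
      source' := by ext; simp
      target' := by ext; simp }
  have h00 : x₀₀ ∈ N := hKN (by simpa using hb 0)
  have h10 : x₁₀ ∈ N := hKN (by simpa using hb 1)
  have h01 : x₀₁ ∈ N := hKN (by simpa using hl 1)
  have h11 : x₁₁ ∈ N := hKN (by simpa using hr 1)
  obtain ⟨F, h1, h2, h3, h4⟩ := exists_square_filler (lift b hb h00 h10) (lift r hr h10 h11)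
    (lift l hl h00 h01) (lift t ht h01 h11)
    (path_homotopic_of_logHull_subset (K := K) hδ (subset_logHull _) (isClosed_logHull hc)
      (logHull_logHull hc).subset _ _ (fun s => by
        rw [Path.trans_apply]; split_ifs; exacts [hb _, hr _]) (fun s => by
        rw [Path.trans_apply]; split_ifs; exacts [hl _, ht _]))
  exact ⟨⟨fun p => F p, by fun_prop⟩, fun p => hN (F p).2, fun x => congrArg Subtype.val (h1 x),
    fun x => congrArg Subtype.val (h2 x), fun x => congrArg Subtype.val (h3 x),
    fun x => congrArg Subtype.val (h4 x)⟩

theorem Path.forall_trans_mem {X : Type*} [TopologicalSpace X] {a b c : X} {p : Path a b}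
    {q : Path b c} {S : Set X} (hp : ∀ s, p s ∈ S) (hq : ∀ s, q s ∈ S) (s : unitInterval) :
    p.trans q s ∈ S := by
  rw [Path.trans_apply]
  split_ifs
  exacts [hp _, hq _]

/-! ### Uniform local path connectedness of path images and of their hulls. -/

/-- Close points of `A` are joined by small paths in `A`. -/
def UniformlyLocallyPathConnected (A : Set ℂ) : Prop :=
  ∀ ε > 0, ∃ δ > 0, ∀ a ∈ A, ∀ b ∈ A, dist a b < δ →
    ∃ P : Path a b, ∀ s, P s ∈ A ∧ dist (P s) a < ε

theorem Path.dist_subpath_lt {a b : ℂ} (γ : Path a b) {s t : unitInterval} {ρ ε : ℝ} {c : ℂ}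
    (h : ∀ u, dist u t < ρ → dist (γ u) c < ε) (hs : dist s t < ρ) (x : unitInterval) :
    dist (γ.subpath s t x) c < ε := by
  have hx : γ.subpath s t x ∈ γ '' Set.uIcc s t := by
    rw [← Path.range_subpath]; exact ⟨x, rfl⟩
  obtain ⟨u, hu, hux⟩ := hx
  rw [← hux]
  refine h u ?_
  rw [Subtype.dist_eq, Real.dist_eq] at hs ⊢
  refine lt_of_le_of_lt ?_ hs
  rcases le_total s t with hst | hst
  · rw [Set.uIcc_of_le hst] at hu
    have h1 : (s : ℝ) ≤ u := hu.1
    have h2 : (u : ℝ) ≤ t := hu.2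
    rw [abs_of_nonpos (by linarith), abs_of_nonpos (by linarith)]
    linarith
  · rw [Set.uIcc_of_ge hst] at hu
    have h1 : (t : ℝ) ≤ u := hu.1
    have h2 : (u : ℝ) ≤ s := hu.2
    rw [abs_of_nonneg (by linarith), abs_of_nonneg (by linarith)]
    linarith

/-- Near a pair of parameters with the same image, run along `γ` to the common point and away from
it. The remaining pairs form a compact set, on which the distance of the images is bounded below. -/
theorem uniformlyLocallyPathConnected_range {x y : ℂ} (γ : Path x y) :
    UniformlyLocallyPathConnected (Set.range γ) := by
  intro ε hε
  let G : Set (unitInterval × unitInterval) := {p | ∃ P : Path (γ p.1) (γ p.2),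
    ∀ s, P s ∈ Set.range γ ∧ dist (P s) (γ p.1) < ε}
  have hG : ∀ p : unitInterval × unitInterval, γ p.1 = γ p.2 → G ∈ 𝓝 p := by
    rintro ⟨s₀, t₀⟩ (h0 : γ s₀ = γ t₀)
    obtain ⟨ρ, hρ, h1⟩ := Metric.continuous_iff.1 γ.continuous s₀ (ε / 2) (by positivity)
    obtain ⟨ρ', hρ', h2⟩ := Metric.continuous_iff.1 γ.continuous t₀ (ε / 2) (by positivity)
    rw [nhds_prod_eq]
    filter_upwards [Filter.prod_mem_prod (Metric.ball_mem_nhds s₀ hρ) (Metric.ball_mem_nhds t₀ hρ')]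
    rintro ⟨s, t⟩ ⟨hs, ht⟩
    refine ⟨(γ.subpath s s₀).trans ((γ.subpath t₀ t).cast h0 rfl), fun u => ⟨?_, ?_⟩⟩
    · rw [Path.trans_apply]
      split_ifs <;> exact ⟨_, rfl⟩
    · have hs' : dist (γ s₀) (γ s) < ε / 2 := by rw [dist_comm]; exact h1 s hs
      suffices h : dist (((γ.subpath s s₀).trans ((γ.subpath t₀ t).cast h0 rfl)) u) (γ s₀) < ε / 2 by
        have := dist_triangle (((γ.subpath s s₀).trans ((γ.subpath t₀ t).cast h0 rfl)) u) (γ s₀)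
          (γ s)
        simp only at this ⊢
        linarith
      rw [Path.trans_apply]
      split_ifs
      · exact Path.dist_subpath_lt γ h1 hs _
      · rw [Path.cast_coe, ← Path.symm_subpath, Path.symm_apply, h0]
        exact Path.dist_subpath_lt γ h2 ht _
  have hcl : IsCompact (interior G)ᶜ := isOpen_interior.isClosed_compl.isCompact
  obtain ⟨δ, hδ, h⟩ := hcl.exists_forall_le' (f := fun p => dist (γ p.1) (γ p.2)) (a := 0)
    (by fun_prop) (fun p hp => dist_pos.2 fun h => hp (mem_interior_iff_mem_nhds.2 (hG p h)))
  refine ⟨δ, hδ, ?_⟩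
  rintro _ ⟨s, rfl⟩ _ ⟨t, rfl⟩ hst
  by_contra hcon
  have := h (s, t) fun hp => hcon (interior_subset (s := G) hp)
  simp only at this
  linarith

/-- On the straight segment from `a` to `b`, the parts before the first and after the last visit to
`K` stay in the hull. What lies between is replaced by a small path in `K`. -/
theorem UniformlyLocallyPathConnected.logHull {K : Set ℂ} (hK : IsCompact K)
    (h : UniformlyLocallyPathConnected K) : UniformlyLocallyPathConnected (logHull K) := by
  intro ε hε
  obtain ⟨δ, hδ, hd⟩ := h (ε / 2) (by positivity)
  refine ⟨min δ (ε / 2), lt_min hδ (by positivity), fun a ha b hb hab => ?_⟩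
  rw [lt_min_iff] at hab
  set L := Path.segment a b
  have hLd : ∀ s, dist (L s) a < ε / 2 := fun s => by
    rw [Path.segment_apply, dist_lineMap_left, Real.norm_of_nonneg s.2.1]
    refine lt_of_le_of_lt ?_ hab.2
    exact mul_le_of_le_one_left dist_nonneg s.2.2
  let T : Set unitInterval := L ⁻¹' K
  have hT : IsCompact T := (hK.isClosed.preimage L.continuous).isCompact
  rcases T.eq_empty_or_nonempty with hTe | hTn
  · refine ⟨L, fun s => ⟨?_, (hLd s).trans (by linarith)⟩⟩
    refine IsPreconnected.subset_logHull hK (isPreconnected_range L.continuous)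
      (Set.disjoint_left.2 ?_) ⟨0, L.source⟩ ha ⟨s, rfl⟩
    rintro _ ⟨u, rfl⟩ hu
    exact (Set.eq_empty_iff_forall_notMem.1 hTe u) hu
  · obtain ⟨s₁, hs₁, hmin⟩ := hT.exists_isLeast hTn
    obtain ⟨s₂, hs₂, hmax⟩ := hT.exists_isGreatest hTn
    have hlo : ∀ s ≤ s₁, L s ∈ _root_.logHull K := by
      intro s hs
      rcases hs.eq_or_lt with rfl | hs
      · exact subset_logHull K hs₁
      refine IsPreconnected.subset_logHull hK (isPreconnected_Icc.image L L.continuous.continuousOn)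
        (Set.disjoint_left.2 ?_) ⟨0, ⟨unitInterval.nonneg', s.2.1⟩, L.source⟩ ha
        ⟨s, ⟨unitInterval.nonneg', le_rfl⟩, rfl⟩
      rintro _ ⟨u, hu, rfl⟩ huK
      exact absurd (hmin huK) (not_le.2 (hu.2.trans_lt hs))
    have hhi : ∀ s, s₂ ≤ s → L s ∈ _root_.logHull K := by
      intro s hs
      rcases hs.eq_or_lt with rfl | hs
      · exact subset_logHull K hs₂
      refine IsPreconnected.subset_logHull hK (isPreconnected_Icc.image L L.continuous.continuousOn)
        (Set.disjoint_left.2 ?_) ⟨1, ⟨s.2.2, le_rfl⟩, L.target⟩ hb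
        ⟨s, ⟨le_rfl, unitInterval.le_one'⟩, rfl⟩
      rintro _ ⟨u, hu, rfl⟩ huK
      exact absurd (hmax huK) (not_le.2 (hs.trans_le hu.1))
    obtain ⟨Q, hQ⟩ := hd (L s₁) hs₁ (L s₂) hs₂ (by
      refine lt_of_le_of_lt ?_ hab.1
      rw [Path.segment_apply, Path.segment_apply, dist_lineMap_lineMap]
      refine mul_le_of_le_one_left dist_nonneg ?_
      rw [Real.dist_eq, abs_le]
      have h1 := s₁.2.1
      have h2 := s₁.2.2
      have h3 := s₂.2.1
      have h4 := s₂.2.2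
      constructor <;> linarith)
    have h1 : ∀ s, L.subpath 0 s₁ s ∈ _root_.logHull K ∩ Metric.ball a ε := fun s => by
      have hx : L.subpath 0 s₁ s ∈ L '' Set.Icc 0 s₁ := by
        rw [← Path.range_subpath_of_le _ _ _ unitInterval.nonneg']; exact ⟨s, rfl⟩
      obtain ⟨u, hu, hux⟩ := hx
      rw [← hux]
      exact ⟨hlo u hu.2, Metric.mem_ball.2 ((hLd u).trans (by linarith))⟩
    have h2 : ∀ s, Q s ∈ _root_.logHull K ∩ Metric.ball a ε := fun s => by
      have hQs := (hQ s).2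
      have hLs := hLd s₁
      refine ⟨subset_logHull K (hQ s).1, Metric.mem_ball.2 ?_⟩
      linarith [dist_triangle (Q s) (L s₁) a]
    have h3 : ∀ s, L.subpath s₂ 1 s ∈ _root_.logHull K ∩ Metric.ball a ε := fun s => by
      have hx : L.subpath s₂ 1 s ∈ L '' Set.Icc s₂ 1 := by
        rw [← Path.range_subpath_of_le _ _ _ unitInterval.le_one']; exact ⟨s, rfl⟩
      obtain ⟨u, hu, hux⟩ := hx
      rw [← hux]
      exact ⟨hhi u hu.1, Metric.mem_ball.2 ((hLd u).trans (by linarith))⟩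
    exact ⟨((L.subpath 0 s₁).trans (Q.trans (L.subpath s₂ 1))).cast L.source.symm L.target.symm,
      Path.forall_trans_mem h1 (Path.forall_trans_mem h2 h3)⟩

/-! ### Gluing over a grid and refining a map near `A`. -/

theorem exists_glue_grid {Y : Type*} [TopologicalSpace Y] (m : ℕ)
    (C : ℕ → ℕ → C(unitInterval × unitInterval, Y))
    (hh : ∀ i j y, C i j (1, y) = C (i + 1) j (0, y))
    (hv : ∀ i j x, C i j (x, 1) = C i (j + 1) (x, 0)) :
    ∃ F : C(unitInterval × unitInterval, Y), ∀ (i j : ℕ) (p : unitInterval × unitInterval),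
      (i : ℝ) ≤ m * p.1 → (m * p.1 : ℝ) ≤ i + 1 → (j : ℝ) ≤ m * p.2 → (m * p.2 : ℝ) ≤ j + 1 →
      F p = C i j (Set.projIcc 0 1 zero_le_one (m * p.1 - i),
        Set.projIcc 0 1 zero_le_one (m * p.2 - j)) := by
  let F : unitInterval × unitInterval → Y := fun p =>
    C ⌊(m * p.1 : ℝ)⌋₊ ⌊(m * p.2 : ℝ)⌋₊
      (Set.projIcc 0 1 zero_le_one (m * p.1 - ⌊(m * p.1 : ℝ)⌋₊),
        Set.projIcc 0 1 zero_le_one (m * p.2 - ⌊(m * p.2 : ℝ)⌋₊))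
  have hfl : ∀ (i : ℕ) (x : ℝ), (i : ℝ) ≤ x → x ≤ i + 1 →
      ⌊x⌋₊ = i ∨ (⌊x⌋₊ = i + 1 ∧ x = i + 1) := by
    intro i x h1 h2
    rcases h2.eq_or_lt with h | h
    · right
      refine ⟨?_, h⟩
      rw [h]; exact_mod_cast Nat.floor_natCast (i + 1)
    · left
      exact (Nat.floor_eq_iff ((Nat.cast_nonneg i).trans h1)).2 ⟨h1, h⟩
  have hF : ∀ (i j : ℕ) (p : unitInterval × unitInterval),
      (i : ℝ) ≤ m * p.1 → (m * p.1 : ℝ) ≤ i + 1 → (j : ℝ) ≤ m * p.2 → (m * p.2 : ℝ) ≤ j + 1 →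
      F p = C i j (Set.projIcc 0 1 zero_le_one (m * p.1 - i),
        Set.projIcc 0 1 zero_le_one (m * p.2 - j)) := by
    intro i j p hi hi' hj hj'
    simp only [F]
    rcases hfl i _ hi hi' with h | ⟨h, hx⟩ <;> rcases hfl j _ hj hj' with h' | ⟨h', hy⟩
    · rw [h, h']
    · rw [h, h', hy]
      simp [hv]
    · rw [h, h', hx]
      simp [hh]
    · rw [h, h', hx, hy]
      simp [hh, hv]
  refine ⟨⟨F, ?_⟩, hF⟩
  -- The extra index is needed because the coordinate `1` has floor `m`.
  let S : Fin (m + 1) × Fin (m + 1) → Set (unitInterval × unitInterval) := fun q =>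
    {p | (q.1 : ℝ) ≤ m * p.1 ∧ (m * p.1 : ℝ) ≤ q.1 + 1 ∧ (q.2 : ℝ) ≤ m * p.2 ∧
      (m * p.2 : ℝ) ≤ q.2 + 1}
  refine (locallyFinite_of_finite S).continuous ?_ ?_ ?_
  · rw [Set.eq_univ_iff_forall]
    intro p
    have hlt : ∀ x : unitInterval, ⌊(m * x : ℝ)⌋₊ < m + 1 := fun x => by
      rw [Nat.lt_succ_iff]
      refine Nat.floor_le_of_le ?_
      exact mul_le_of_le_one_right (by positivity) x.2.2
    have hnn : ∀ x : unitInterval, (0 : ℝ) ≤ m * x := fun x => mul_nonneg (by positivity) x.2.1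
    exact Set.mem_iUnion.2 ⟨(⟨_, hlt p.1⟩, ⟨_, hlt p.2⟩), Nat.floor_le (hnn _),
      (Nat.lt_floor_add_one _).le, Nat.floor_le (hnn _), (Nat.lt_floor_add_one _).le⟩
  · intro q
    simp only [S, Set.ofPred_and]
    refine IsClosed.inter ?_ (IsClosed.inter ?_ (IsClosed.inter ?_ ?_)) <;>
    exact isClosed_le (by fun_prop) (by fun_prop)
  · intro q
    refine ContinuousOn.congr (f := fun p : unitInterval × unitInterval =>
      C q.1 q.2 (Set.projIcc 0 1 zero_le_one (m * p.1 - (q.1 : ℕ)),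
        Set.projIcc 0 1 zero_le_one (m * p.2 - (q.2 : ℕ)))) ?_
      fun p hp => hF q.1 q.2 p hp.1 hp.2.1 hp.2.2.1 hp.2.2.2
    refine Continuous.continuousOn ((C q.1 q.2).continuous.comp (Continuous.prodMk ?_ ?_)) <;>
    exact continuous_projIcc.comp (by fun_prop)

/-- The boundary of the unit square. -/
def squareBoundary : Set (unitInterval × unitInterval) :=
  {p | p.1 = 0 ∨ p.1 = 1 ∨ p.2 = 0 ∨ p.2 = 1}

/-- The `x`-th point of the subdivision of the unit interval into `m` pieces. -/
noncomputable def gridPoint (m : ℕ) (x : ℝ) : unitInterval := Set.projIcc 0 1 zero_le_one (x / m)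

theorem continuous_gridPoint (m : ℕ) : Continuous (gridPoint m) :=
  continuous_projIcc.comp (by fun_prop)

theorem gridPoint_zero (m : ℕ) : gridPoint m 0 = 0 := by
  simp [gridPoint]

theorem gridPoint_self {m : ℕ} (hm : 0 < m) : gridPoint m m = 1 := by
  rw [gridPoint, div_self (by positivity), Set.projIcc_right zero_le_one]; rfl

theorem gridPoint_mul {m : ℕ} (hm : 0 < m) (x : unitInterval) : gridPoint m (m * x) = x := by
  rw [gridPoint, mul_div_cancel_left₀ _ (by positivity), Set.projIcc_val]

theorem dist_gridPoint_le {m : ℕ} {x y c : ℝ} (h : |x - y| ≤ 1) (hc : 1 / m ≤ c) :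
    dist (gridPoint m x) (gridPoint m y) ≤ c := by
  rw [Subtype.dist_eq, Real.dist_eq]
  refine (Set.abs_projIcc_sub_projIcc zero_le_one).trans (le_trans ?_ hc)
  rw [← sub_div, abs_div, Nat.abs_cast]
  gcongr

/-- A path in `A` that approximates the path `f`, and equals it if `f` itself runs in `A`. -/
theorem exists_path_approx {A : Set ℂ} {e δ δ' : ℝ} (hδ'e : δ ≤ e) (h4 : 3 * δ ≤ δ')
    (hU : ∀ a ∈ A, ∀ b ∈ A, dist a b < δ' → ∃ P : Path a b, ∀ s, P s ∈ A ∧ dist (P s) a < e)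
    (f : C(unitInterval, ℂ)) (hf : ∀ s, dist (f s) (f 0) < δ) {a b : ℂ} (ha : a ∈ A) (hb : b ∈ A)
    (haf : dist a (f 0) < δ) (hbf : dist b (f 1) < δ)
    (hfA : (∀ s, f s ∈ A) → a = f 0 ∧ b = f 1) :
    ∃ P : Path a b, (∀ s, P s ∈ A ∧ dist (P s) (f 0) < 2 * e) ∧
      ((∀ s, f s ∈ A) → ∀ s, P s = f s) := by
  by_cases h : ∀ s, f s ∈ A
  · obtain ⟨rfl, rfl⟩ := hfA h
    refine ⟨⟨f, rfl, rfl⟩, fun s => ⟨h s, ?_⟩, fun _ s => rfl⟩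
    have := hf s
    have h0 := dist_nonneg.trans_lt this
    exact this.trans_le (by linarith)
  · obtain ⟨P, hP⟩ := hU a ha b hb (by
      have h1 := dist_triangle a (f 0) b
      have h2 := dist_triangle_right (f 0) b (f 1)
      have h3 := hf 1
      rw [dist_comm] at h3
      linarith)
    refine ⟨P, fun s => ⟨(hP s).1, ?_⟩, fun h' => absurd h' h⟩
    have := (hP s).2
    linarith [dist_triangle (P s) a (f 0)]

/-- A map of the square into a small neighbourhood of `A` can be moved slightly, relative to the
boundary, into an arbitrarily small neighbourhood of `A`. -/
theorem exists_refinement {A : Set ℂ} (hA : IsCompact A) (hAA : logHull A ⊆ A)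
    (hU : UniformlyLocallyPathConnected A) {ε : ℝ} (hε : 0 < ε) :
    ∃ δ > 0, ∀ F : C(unitInterval × unitInterval, ℂ), (∀ p, ∃ a ∈ A, dist a (F p) < δ) →
      (∀ p ∈ squareBoundary, F p ∈ A) → ∀ η > 0, ∃ F' : C(unitInterval × unitInterval, ℂ),
        (∀ p, ∃ a ∈ A, dist a (F' p) < η) ∧ (∀ p ∈ squareBoundary, F' p = F p) ∧
        dist F F' ≤ ε := by
  -- Error budget: oscillation `δ ≤ e` of `F` on a cell, plus `4 * e` for the new cell, of which `3
  -- * e` holds its edges and `e` is the thickening.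
  obtain ⟨e, he, he5⟩ : ∃ e > 0, 5 * e ≤ ε := ⟨ε / 5, by positivity, by linarith⟩
  obtain ⟨δ', hδ', hd⟩ := hU e he
  obtain ⟨δ, hδ, h4, hδe⟩ : ∃ δ > 0, 3 * δ ≤ δ' ∧ δ ≤ e :=
    ⟨min (δ' / 3) e, lt_min (by positivity) he, by
      linarith [min_le_left (δ' / 3) e], min_le_right _ _⟩
  refine ⟨δ, hδ, fun F hFA hFb η hη => ?_⟩
  have huc : UniformContinuous F := CompactSpace.uniformContinuous_of_continuous F.continuous
  obtain ⟨ρ, hρ, hosc⟩ := Metric.uniformContinuous_iff.1 huc δ hδ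
  obtain ⟨n, hn⟩ := exists_nat_one_div_lt hρ
  obtain ⟨m, hm, hmρ⟩ : ∃ m : ℕ, 0 < m ∧ (1 : ℝ) / m < ρ := ⟨n + 1, by omega, by exact_mod_cast hn⟩
  -- `gridPoint` clamps to the interval, so cells can be indexed by all natural numbers, those
  -- beyond the square included.
  let G : ℝ → ℝ → ℂ := fun x y => F (gridPoint m x, gridPoint m y)
  have hGosc : ∀ x y x' y' : ℝ, |x - x'| ≤ 1 → |y - y'| ≤ 1 → dist (G x y) (G x' y') < δ :=
    fun x y x' y' h1 h2 => hosc (by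
      rw [Prod.dist_eq]
      exact max_lt ((dist_gridPoint_le h1 le_rfl).trans_lt hmρ)
        ((dist_gridPoint_le h2 le_rfl).trans_lt hmρ))
  have hGc : Continuous (fun p : ℝ × ℝ => G p.1 p.2) :=
    F.continuous.comp (((continuous_gridPoint m).comp continuous_fst).prodMk
      ((continuous_gridPoint m).comp continuous_snd))
  -- Grid values already in `A` are kept; this, with the same rule for edges, leaves the boundary
  -- fixed.
  have hV : ∀ i j : ℕ, ∃ a ∈ A, dist a (G i j) < δ ∧ (G i j ∈ A → a = G i j) := fun i j => by
    by_cases h : G i j ∈ A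
    · exact ⟨_, h, by simpa using hδ, fun _ => rfl⟩
    · obtain ⟨a, ha, had⟩ := hFA (gridPoint m i, gridPoint m j)
      exact ⟨a, ha, had, fun h' => absurd h' h⟩
  choose V hVA hVd hVe using hV
  have hP : ∀ i j : ℕ, ∃ P : Path (V i j) (V (i + 1) j),
      (∀ s, P s ∈ A ∧ dist (P s) (G i j) < 2 * e) ∧
      ((∀ s : unitInterval, G (i + s) j ∈ A) → ∀ s : unitInterval, P s = G (i + s) j) := by
    intro i j
    have := exists_path_approx hδe h4 hd
      ⟨fun s : unitInterval => G (i + s) j, hGc.comp (f := fun s : unitInterval => ((i : ℝ) + s, (j : ℝ))) (by fun_prop)⟩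
      (fun s => hGosc _ _ _ _ (by simp [abs_of_nonneg s.2.1, s.2.2]) (by simp)) (hVA i j)
      (hVA (i + 1) j) (by simpa using hVd i j) (by simpa using hVd (i + 1) j) (fun h =>
        ⟨by simpa using hVe i j (by simpa using h 0),
          by simpa using hVe (i + 1) j (by simpa using h 1)⟩)
    simpa using this
  have hQ : ∀ i j : ℕ, ∃ P : Path (V i j) (V i (j + 1)),
      (∀ s, P s ∈ A ∧ dist (P s) (G i j) < 2 * e) ∧
      ((∀ s : unitInterval, G i (j + s) ∈ A) → ∀ s : unitInterval, P s = G i (j + s)) := by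
    intro i j
    have := exists_path_approx hδe h4 hd
      ⟨fun s : unitInterval => G i (j + s), hGc.comp (f := fun s : unitInterval => ((i : ℝ), (j : ℝ) + s)) (by fun_prop)⟩
      (fun s => hGosc _ _ _ _ (by simp) (by simp [abs_of_nonneg s.2.1, s.2.2])) (hVA i j)
      (hVA i (j + 1)) (by simpa using hVd i j) (by simpa using hVd i (j + 1)) (fun h =>
        ⟨by simpa using hVe i j (by simpa using h 0),
          by simpa using hVe i (j + 1) (by simpa using h 1)⟩)
    simpa using this
  choose P hP hPb using hP
  choose Q hQ hQb using hQ
  have hC : ∀ i j : ℕ, ∃ C : C(unitInterval × unitInterval, ℂ),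
      (∀ p, (∃ a ∈ A, dist a (C p) < η) ∧ dist (G i j) (C p) < 4 * e) ∧
      (∀ x, C (x, 0) = P i j x) ∧ (∀ x, C (x, 1) = P i (j + 1) x) ∧
      (∀ y, C (0, y) = Q i j y) ∧ (∀ y, C (1, y) = Q (i + 1) j y) := by
    intro i j
    have hK : IsCompact (A ∩ Metric.closedBall (G i j) (3 * e)) :=
      hA.inter_right Metric.isClosed_closedBall
    set K := A ∩ Metric.closedBall (G i j) (3 * e)
    have hη' : 0 < min η e := lt_min hη he
    have hstep : ∀ i' j' : ℕ, |(i' : ℝ) - i| ≤ 1 → |(j' : ℝ) - j| ≤ 1 → ∀ z : ℂ,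
        z ∈ A ∧ dist z (G i' j') < 2 * e → z ∈ K := by
      intro i' j' h1 h2 z ⟨hz, hzd⟩
      have := hGosc i' j' i j h1 h2
      exact ⟨hz, by rw [Metric.mem_closedBall]; linarith [dist_triangle z (G i' j') (G i j)]⟩
    obtain ⟨C, hCU, h1, h2, h3, h4⟩ := exists_square_filler_of_logHull_subset hK
      (Metric.isOpen_thickening (δ := min η e)) (Metric.self_subset_thickening hη' (logHull K))
      (P i j) (Q (i + 1) j) (Q i j) (P i (j + 1))
      (fun s => hstep i j (by simp) (by simp) _ (hP i j s))
      (fun s => hstep (i + 1) j (by simp) (by simp) _ (hQ (i + 1) j s))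
      (fun s => hstep i j (by simp) (by simp) _ (hQ i j s))
      (fun s => hstep i (j + 1) (by simp) (by simp) _ (hP i (j + 1) s))
    refine ⟨C, fun p => ?_, h1, h2, h3, h4⟩
    obtain ⟨z, hz, hzd⟩ := Metric.mem_thickening_iff.1 (hCU p)
    rw [lt_min_iff, dist_comm] at hzd
    refine ⟨⟨z, hAA (logHull_mono Set.inter_subset_left hz), hzd.1⟩, ?_⟩
    have h5 := logHull_subset_closedBall Set.inter_subset_right hz
    rw [Metric.mem_closedBall, dist_comm] at h5
    have h6 := hzd.2
    linarith [dist_triangle (G i j) z (C p)]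
  choose C hC1 hC2 hC3 hC4 hC5 using hC
  obtain ⟨F', hF'⟩ := exists_glue_grid m C (fun i j y => by rw [hC5, hC4])
    (fun i j x => by rw [hC3, hC2])
  have hnn : ∀ x : unitInterval, (0 : ℝ) ≤ m * x := fun x => mul_nonneg (by positivity) x.2.1
  have hcell : ∀ p, F' p = C ⌊(m * p.1 : ℝ)⌋₊ ⌊(m * p.2 : ℝ)⌋₊ _ := fun p =>
    hF' ⌊(m * p.1 : ℝ)⌋₊ ⌊(m * p.2 : ℝ)⌋₊ p (Nat.floor_le (hnn _)) (Nat.lt_floor_add_one _).le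
      (Nat.floor_le (hnn _)) (Nat.lt_floor_add_one _).le
  have hproj : ∀ x : unitInterval, (((Set.projIcc 0 1 zero_le_one
      (m * x - ⌊(m * x : ℝ)⌋₊) : unitInterval) : ℝ)) = m * x - ⌊(m * x : ℝ)⌋₊ := fun x => by
    rw [Set.projIcc_of_mem zero_le_one ⟨?_, ?_⟩]
    · linarith [Nat.floor_le (hnn x)]
    · linarith [Nat.lt_floor_add_one (m * x : ℝ)]
  have h0 : Set.projIcc (0 : ℝ) 1 zero_le_one 0 = 0 := Set.projIcc_left zero_le_one
  refine ⟨F', fun p => ?_, ?_, ?_⟩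
  · rw [hcell p]; exact (hC1 _ _ _).1
  · have hrow : ∀ (x : unitInterval) (j : ℕ) (y : unitInterval), gridPoint m j = y →
        (m * y : ℝ) = j → (y = 0 ∨ y = 1) → F' (x, y) = F (x, y) := by
      intro x j y hj hjy hy
      rw [hF' ⌊(m * x : ℝ)⌋₊ j (x, y) (Nat.floor_le (hnn _)) (Nat.lt_floor_add_one _).le hjy.ge
        (by simp only; linarith)]
      simp only [hjy, sub_self, h0]
      rw [hC2, hPb _ _ (fun s => hFb _ (by rw [hj]; exact Or.inr (Or.inr hy))), hproj x]
      simp only [G]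
      rw [add_sub_cancel, gridPoint_mul hm, hj]
    have hcol : ∀ (y : unitInterval) (i : ℕ) (x : unitInterval), gridPoint m i = x →
        (m * x : ℝ) = i → (x = 0 ∨ x = 1) → F' (x, y) = F (x, y) := by
      intro y i x hi hix hx
      rw [hF' i ⌊(m * y : ℝ)⌋₊ (x, y) hix.ge (by simp only; linarith) (Nat.floor_le (hnn _))
        (Nat.lt_floor_add_one _).le]
      simp only [hix, sub_self, h0]
      rw [hC4, hQb _ _ (fun s => hFb _ (by
        rw [hi]; exact hx.elim Or.inl fun h => Or.inr (Or.inl h))), hproj y]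
      simp only [G]
      rw [add_sub_cancel, gridPoint_mul hm, hi]
    rintro ⟨x, y⟩ (h | h | h | h) <;> simp only at h <;> subst h
    · exact hcol y 0 0 (by simpa using gridPoint_zero m) (by simp) (Or.inl rfl)
    · exact hcol y m 1 (gridPoint_self hm) (by simp) (Or.inr rfl)
    · exact hrow x 0 0 (by simpa using gridPoint_zero m) (by simp) (Or.inl rfl)
    · exact hrow x m 1 (gridPoint_self hm) (by simp) (Or.inr rfl)
  · rw [ContinuousMap.dist_le hε.le]
    intro p
    rw [hcell p]
    refine le_trans ?_ he5
    have h1 := (hC1 ⌊(m * p.1 : ℝ)⌋₊ ⌊(m * p.2 : ℝ)⌋₊ (Set.projIcc 0 1 zero_le_one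
      (m * p.1 - ⌊(m * p.1 : ℝ)⌋₊), Set.projIcc 0 1 zero_le_one (m * p.2 - ⌊(m * p.2 : ℝ)⌋₊))).2
    have h2 : dist (F p) (G ⌊(m * p.1 : ℝ)⌋₊ ⌊(m * p.2 : ℝ)⌋₊) < δ := by
      have h3 : F p = G (m * p.1) (m * p.2) := by
        simp only [G]; rw [gridPoint_mul hm, gridPoint_mul hm]
      rw [h3]
      have habs : ∀ x : unitInterval, |(m * x : ℝ) - ⌊(m * x : ℝ)⌋₊| ≤ 1 := fun x => by
        rw [abs_of_nonneg (by linarith [Nat.floor_le (hnn x)])]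
        linarith [Nat.lt_floor_add_one (m * x : ℝ)]
      exact hGosc _ _ _ _ (habs _) (habs _)
    refine (dist_triangle _ _ _).trans (add_le_add h2.le h1.le |>.trans ?_)
    linarith

/-! ### Squares and null-homotopies inside a filled set. -/

/-- Two ways around a square inside a locally connected filled set `A` bound a square in `A`. -/
theorem exists_square_filler_mem {A : Set ℂ} (hA : IsCompact A) (hAA : logHull A ⊆ A)
    (hU : UniformlyLocallyPathConnected A) {x₀₀ x₁₀ x₀₁ x₁₁ : ℂ} (b : Path x₀₀ x₁₀)
    (r : Path x₁₀ x₁₁) (l : Path x₀₀ x₀₁) (t : Path x₀₁ x₁₁) (hb : ∀ s, b s ∈ A)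
    (hr : ∀ s, r s ∈ A) (hl : ∀ s, l s ∈ A) (ht : ∀ s, t s ∈ A) :
    ∃ F : C(unitInterval × unitInterval, ℂ), (∀ p, F p ∈ A) ∧ (∀ x, F (x, 0) = b x) ∧
      (∀ x, F (x, 1) = t x) ∧ (∀ y, F (0, y) = l y) ∧ (∀ y, F (1, y) = r y) := by
  have hpow : ∀ n : ℕ, (0 : ℝ) < (1 / 2) ^ n := fun n => by positivity
  choose δ hδ hstep using fun n : ℕ => exists_refinement hA hAA hU (hpow n)
  -- The bound `δ n` permits the next refinement; the geometric bound forces the limit into `A`.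
  let η : ℕ → ℝ := fun n => min (δ n) ((1 / 2) ^ n)
  have hη : ∀ n, 0 < η n := fun n => lt_min (hδ n) (hpow n)
  obtain ⟨F₀, hF₀, h1, h2, h3, h4⟩ := exists_square_filler_of_logHull_subset hA
    (Metric.isOpen_thickening (δ := η 0)) (hAA.trans (Metric.self_subset_thickening (hη 0) A))
    b r l t hb hr hl ht
  have hF₀b : ∀ p ∈ squareBoundary, F₀ p ∈ A := by
    rintro ⟨x, y⟩ (h | h | h | h) <;> simp only at h <;> subst h
    · rw [h3]; exact hl _
    · rw [h4]; exact hr _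
    · rw [h1]; exact hb _
    · rw [h2]; exact ht _
  let S : ℕ → Type := fun n => {F : C(unitInterval × unitInterval, ℂ) //
    (∀ p, ∃ a ∈ A, dist a (F p) < η n) ∧ ∀ p ∈ squareBoundary, F p = F₀ p}
  have hnext : ∀ n (F : S n), ∃ F' : S (n + 1), dist F.1 F'.1 ≤ 1 * (1 / 2) ^ n := by
    rintro n ⟨F, hF, hFb⟩
    obtain ⟨F', h1, h2, h3⟩ := hstep n F (fun p => by
      obtain ⟨a, ha, had⟩ := hF p
      exact ⟨a, ha, had.trans_le (min_le_left _ _)⟩)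
      (fun p hp => by rw [hFb p hp]; exact hF₀b p hp) (η (n + 1)) (hη _)
    exact ⟨⟨F', h1, fun p hp => (h2 p hp).trans (hFb p hp)⟩, by simpa using h3⟩
  choose next hnext using hnext
  let u : ∀ n, S n := fun n => Nat.rec (motive := S) ⟨F₀, fun p => by
    obtain ⟨a, ha, had⟩ := Metric.mem_thickening_iff.1 (hF₀ p)
    exact ⟨a, ha, by rwa [dist_comm]⟩, fun _ _ => rfl⟩ (fun n F => next n F) n
  have hu : ∀ n, dist (u n).1 (u (n + 1)).1 ≤ 1 * (1 / 2) ^ n := fun n => hnext n (u n)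
  obtain ⟨F, hF⟩ := cauchySeq_tendsto_of_complete
    (cauchySeq_of_le_geometric (1 / 2) 1 (by norm_num) hu)
  have hFp : ∀ p, Filter.Tendsto (fun n => (u n).1 p) Filter.atTop (𝓝 (F p)) := fun p =>
    ((continuous_eval_const p).tendsto F).comp hF
  have hFb : ∀ p ∈ squareBoundary, F p = F₀ p := fun p hp =>
    tendsto_nhds_unique (hFp p) (tendsto_const_nhds.congr fun n => ((u n).2.2 p hp).symm)
  refine ⟨F, fun p => ?_, fun x => ?_, fun x => ?_, fun y => ?_, fun y => ?_⟩
  · choose a ha had using fun n => (u n).2.1 p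
    refine hA.isClosed.mem_of_tendsto (b := Filter.atTop) (f := a) ?_ (.of_forall ha)
    refine (hFp p).congr_dist ?_
    refine squeeze_zero (fun _ => dist_nonneg) (fun n => ?_)
      (tendsto_pow_atTop_nhds_zero_of_lt_one (r := (1 / 2 : ℝ)) (by norm_num) (by norm_num))
    rw [dist_comm]
    exact (had n).le.trans (min_le_right _ _)
  · rw [hFb _ (Or.inr (Or.inr (Or.inl rfl))), h1]
  · rw [hFb _ (Or.inr (Or.inr (Or.inr rfl))), h2]
  · rw [hFb _ (Or.inl rfl), h3]
  · rw [hFb _ (Or.inr (Or.inl rfl)), h4]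

/-- A loop in a planar space whose hull is contained in the space is null-homotopic. -/
theorem Path.homotopic_refl_of_logHull_subset {X : Type*} [TopologicalSpace X] {e : X → ℂ}
    (he : IsEmbedding e) {x : X} (p : Path x x)
    (hp : logHull (e '' Set.range p) ⊆ Set.range e) : p.Homotopic (Path.refl x) := by
  let γ : Path (e x) (e x) := p.map he.continuous
  have hγ : Set.range γ = e '' Set.range p := by
    rw [← Set.range_comp]; rfl
  have hK : IsCompact (Set.range γ) := isCompact_range γ.continuous
  have hmem : ∀ s, γ s ∈ logHull (Set.range γ) := fun s => subset_logHull _ ⟨s, rfl⟩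
  have hmemx : ∀ s, Path.refl (e x) s ∈ logHull (Set.range γ) := fun s => by
    simpa using hmem 0
  -- The loop is the bottom of the square and the other three sides are constant, so the filler is a
  -- null-homotopy with coordinates exchanged.
  obtain ⟨F, hF, h1, h2, h3, h4⟩ := exists_square_filler_mem (isCompact_logHull hK)
    (logHull_logHull hK).subset ((uniformlyLocallyPathConnected_range γ).logHull hK) γ
    (Path.refl _) (Path.refl _) (Path.refl _) hmem hmemx hmemx hmemx
  choose Φ hΦ using fun q => hp (hγ ▸ hF q)
  have hΦc : Continuous Φ := he.continuous_iff.2 (by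
    have : e ∘ Φ = F := funext hΦ
    rw [this]; exact F.continuous)
  refine ⟨⟨⟨⟨fun q => Φ (q.2, q.1), by fun_prop⟩, fun s => ?_, fun s => ?_⟩, ?_⟩⟩
  · exact he.injective ((hΦ _).trans (h1 s))
  · exact he.injective ((hΦ _).trans (h2 s))
  · rintro τ s (rfl | rfl)
    · exact he.injective ((hΦ _).trans ((h3 τ).trans (congrArg e p.source).symm))
    · exact he.injective ((hΦ _).trans ((h4 τ).trans (congrArg e p.target).symm))

/-! ### Transporting logarithms along the homotopy, and the conclusion. -/

theorem hasLog_range_of_isEmbedding {α : Type*} [TopologicalSpace α] {j : α → ℂ}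
    (hj : IsEmbedding j) {φ : ℂ → ℂ} (g : C(α, ℂ)) (hg : ∀ a, Complex.exp (g a) = φ (j a)) :
    HasLog (Set.range j) φ := by
  classical
  let J := hj.toHomeomorph
  have hJ : ∀ z : Set.range j, j (J.symm z) = z := fun z =>
    congrArg Subtype.val (J.apply_symm_apply z)
  refine ⟨fun z => if h : z ∈ Set.range j then g (J.symm ⟨z, h⟩) else 0, ?_, fun z hz => ?_⟩
  · rw [continuousOn_iff_continuous_domRestrict]
    refine (g.continuous.comp J.symm.continuous).congr fun z => ?_
    simp [Set.domRestrict]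
  · simp only [hz, dif_pos, hg, hJ]

/-- If a homotopy moves `f x` to `x`, then loops near `x` only surround points of the space. -/
theorem exists_nhds_logHull_subset {X : Type*} [TopologicalSpace X] {e : X → ℂ}
    (he : IsEmbedding e) {f : C(X, X)} (H : f.Homotopy (ContinuousMap.id X)) {x : X}
    (hx : f x ≠ x) :
    ∃ U ∈ 𝓝 x, ∀ S ⊆ U, logHull (e '' S) ⊆ Set.range e := by
  have hD : 0 < dist (e x) (e (f x)) := dist_pos.2 fun h => hx (he.injective h).symm
  -- No point is within `ε` of both `e x` and `e (f x)`, as these are at least `3 * ε` apart.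
  obtain ⟨ε, hε, hεD⟩ : ∃ ε > 0, 3 * ε ≤ dist (e x) (e (f x)) :=
    ⟨dist (e x) (e (f x)) / 3, by positivity, by linarith⟩
  refine ⟨e ⁻¹' Metric.ball (e x) ε ∩ (e ∘ f) ⁻¹' Metric.ball (e (f x)) ε, Filter.inter_mem
    (he.continuous.continuousAt.preimage_mem_nhds (Metric.ball_mem_nhds _ hε))
    ((he.continuous.comp f.continuous).continuousAt.preimage_mem_nhds
      (Metric.ball_mem_nhds _ hε)), fun S hS q hq => ?_⟩
  by_contra hqe
  have hqx : dist q (e x) ≤ ε := logHull_subset_closedBall (c := e x) (r := ε) (by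
    rintro _ ⟨y, hy, rfl⟩
    exact Metric.ball_subset_closedBall (hS hy).1) hq
  have hqf : q ∉ logHull (e '' (f '' S)) := fun hq' => by
    have h1 := logHull_subset_closedBall (c := e (f x)) (r := ε) (by
      rintro _ ⟨_, ⟨y, hy, rfl⟩, rfl⟩
      exact Metric.ball_subset_closedBall (hS hy).2) hq'
    rw [Metric.mem_closedBall] at h1
    linarith [dist_triangle_left (e x) (e (f x)) q]
  obtain ⟨g, hg, hge⟩ := not_not.1 hqf
  -- The homotopy stays in `X` and `q` is not in the image of `X`, so this difference never
  -- vanishes.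
  let G : C(unitInterval × S, ℂ) := ⟨fun p => e (H (p.1, p.2)) - q,
    (he.continuous.comp (by fun_prop)).sub continuous_const⟩
  have hmem : ∀ y : S, e (f y) ∈ e '' (f '' S) := fun y => ⟨f y, ⟨y, y.2, rfl⟩, rfl⟩
  obtain ⟨g', hg'⟩ := exists_log_of_homotopy G
    (fun p h => hqe ⟨_, sub_eq_zero.1 h⟩)
    ⟨fun y => g (e (f y)), hg.comp_continuous
      (he.continuous.comp (f.continuous.comp continuous_subtype_val)) hmem⟩ (fun y => by
        simpa [G] using hge _ (hmem y))
  refine hq ?_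
  have hr : e '' S = Set.range (e ∘ ((↑) : S → X)) := by
    rw [Set.range_comp, Subtype.range_coe]
  rw [hr]
  refine hasLog_range_of_isEmbedding (he.comp IsEmbedding.subtypeVal) g' fun y => ?_
  rw [hg' y]
  simp [G]

theorem mainTheorem7 {X : Type*} [TopologicalSpace X] (hX : IsPlanarPeanoContinuum X)
    (f : C(X, X)) (hf : f.Homotopic (ContinuousMap.id X)) (x : X) (hx : x ∈ badSet X) :
    f x = x := by
  by_contra hfx
  obtain ⟨i, hi⟩ := hX.planar
  obtain ⟨H⟩ := hf
  have he : IsEmbedding (Complex.orthonormalBasisOneI.repr.symm ∘ i) :=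
    Complex.orthonormalBasisOneI.repr.symm.toHomeomorph.isEmbedding.comp hi
  obtain ⟨U, hU, h⟩ := exists_nhds_logHull_subset he H hfx
  exact hx ⟨U, hU, fun p hp => Path.homotopic_refl_of_logHull_subset he p (h _ hp)⟩
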